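/- Let $C$ and $C'$ be simplex cones, $K$ a compact base of $C$ and $K'$ a compact base of $C'$, and assume that $C$ and $C'$ are affinely homeomorphic. Then: 1. There is an affine isomorphism (affine bijection, not necessarily continuous) from $K$ onto $K'$ which restricts to a homeomorphism from the extreme boundary $\partial_e K$ of $K$ onto the extreme boundary $\partial_e K'$ of $K'$. 2. If $K$ is a Bauer simplex, then $K$ and $K'$ are affinely homeomorphic. Here cones are convex cones containing $0$ in Hausdorff locally convex real topological vector spaces. A *base* of a cone $C$ is a convex subset $K\subseteq C$ with $0\notin K$ such that every $c\in C\setminus\{0\}$ can be written uniquely as $c=tk$ with $t>0$ and $k\in K$. A *lattice cone* is a cone $C$ with $C\cap(-C)=\{0\}$ that is a lattice in the order $x\le y\Leftrightarrow y-x\in C$. A *simplex cone* is a lattice cone that is second countable in the relative topology (for example, because the ambient space is second countable) and contains a compact base. A *Choquet simplex* is a compact convex set affinely isomorphic to a base of a lattice cone; it is a *Bauer simplex* if its extreme boundary is closed. Two convex sets are *affinely homeomorphic* if there is an affine homeomorphism from one onto the other, for the relative topologies. -/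

import Mathlib

universe u v

namespace SimplexCone

section Affine

variable {E : Type u} {F : Type v} [AddCommGroup E] [Module ℝ E] [AddCommGroup F] [Module ℝ F]

/-- A map between (convex) subsets of real vector spaces is affine if it preserves convex
combinations of two points. -/
def IsAffine {K : Set E} {L : Set F} (f : K → L) : Prop :=
  ∀ (x y z : K) (a b : ℝ), 0 ≤ a → 0 ≤ b → a + b = 1 →
    (z : E) = a • (x : E) + b • (y : E) → (f z : F) = a • (f x : F) + b • (f y : F)

/-- There is an affine bijection from `K` onto `L` (no topology involved). -/
def AffinelyIsomorphic (K : Set E) (L : Set F) : Prop :=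
  ∃ e : K ≃ L, IsAffine e

/-- There is an affine homeomorphism from `K` onto `L`, both with the relative topology. -/
def AffinelyHomeomorphic [TopologicalSpace E] [TopologicalSpace F]
    (K : Set E) (L : Set F) : Prop :=
  ∃ e : K ≃ₜ L, IsAffine e

/-- There is an affine bijection from `K` onto `L` that restricts to a homeomorphism from the
extreme boundary of `K` onto the extreme boundary of `L`. -/
def StronglyAffinelyIsomorphic [TopologicalSpace E] [TopologicalSpace F]
    (K : Set E) (L : Set F) : Prop :=
  ∃ e : K ≃ L, IsAffine e ∧
    ∃ h : K.extremePoints ℝ ≃ₜ L.extremePoints ℝ,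
      ∀ x : K.extremePoints ℝ, (h x : F) = e ⟨x, extremePoints_subset x.2⟩

end Affine

section Cones

variable {E : Type u} [AddCommGroup E] [Module ℝ E]

/-- `K` is a base for the convex cone `C`: a convex subset of `C` not containing `0` such that each
nonzero element of `C` is uniquely of the form `t • k` with `0 < t` and `k ∈ K`.
(The condition `0 ∉ K` follows from the others unless `C = {0}`.) -/
def IsBase (C : PointedCone ℝ E) (K : Set E) : Prop :=
  K ⊆ C ∧ Convex ℝ K ∧ (0 : E) ∉ K ∧
    ∀ c ∈ C, c ≠ 0 → ∃! p : ℝ × E, 0 < p.1 ∧ p.2 ∈ K ∧ c = p.1 • p.2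

/-- A lattice cone: a convex cone `C` containing `0` with `C ∩ -C = {0}` which is a lattice in the
order `x ≤ y ↔ y - x ∈ C`. -/
def IsLatticeCone (C : PointedCone ℝ E) : Prop :=
  (∀ x ∈ C, -x ∈ C → x = 0) ∧
  ∀ x ∈ C, ∀ y ∈ C,
    (∃ s ∈ C, s - x ∈ C ∧ s - y ∈ C ∧ ∀ z ∈ C, z - x ∈ C → z - y ∈ C → z - s ∈ C) ∧
    (∃ i ∈ C, x - i ∈ C ∧ y - i ∈ C ∧ ∀ z ∈ C, x - z ∈ C → y - z ∈ C → i - z ∈ C)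

/-- A simplex cone: a lattice cone which is second countable in the relative topology and contains
a compact base. -/
def IsSimplexCone [TopologicalSpace E] (C : PointedCone ℝ E) : Prop :=
  IsLatticeCone C ∧ SecondCountableTopology (C : Set E) ∧ ∃ K : Set E, IsCompact K ∧ IsBase C K

/-- A Choquet simplex: a compact convex set that is affinely isomorphic to a base of a lattice
cone in some real vector space. (Restricting that space to the universe of `E` is harmless: the
linear span of the cone over `K` in `E × ℝ` will do.) -/
def IsChoquetSimplex [TopologicalSpace E] (K : Set E) : Prop :=
  IsCompact K ∧ Convex ℝ K ∧
    ∃ (F : Type u) (_ : AddCommGroup F) (_ : Module ℝ F) (D : PointedCone ℝ F) (S : Set F),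
      IsLatticeCone D ∧ IsBase D S ∧ AffinelyIsomorphic K S

/-- A Bauer simplex: a Choquet simplex whose extreme boundary is closed. -/
def IsBauerSimplex [TopologicalSpace E] (K : Set E) : Prop :=
  IsChoquetSimplex K ∧ IsClosed (K.extremePoints ℝ)

end Cones

end SimplexCone

/-! Let `φ : C → C'` be the affine homeomorphism, which fixes the apex and so is linear on the cone,
let `χ` be its inverse, let `f` be the coefficient functional of `K`, and let `g x` be the
coefficient of `φ x` with respect to `K'`. Rescaling, `x ↦ (g x)⁻¹ • φ x`, gives a homeomorphism `K
→ K'` that preserves extreme points, because these span the extreme rays; but it is only projective.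
The cure is a linear bijection `T` of `C` with `f (T x) = g x` and `T x = g x • x` at the extreme
points of `K`. Then `T ∘ χ` maps `K'` affinely onto `K`, and its inverse agrees with the projective
map on the extreme boundary.

Morally `T x` is the barycenter of `g μ`, where `μ` is the maximal measure representing `x`. Finite
decompositions of `x` in `C` take the place of measures: by Riesz decomposition they are directed in
the Choquet order. For a decomposition `D` put `S D = ∑ (g c / f c) • c`. For a continuous
functional `l`, polarization writes `l (S D)` as a quarter of the difference of the total energies
`(l ± g)² / f`. These increase with `D`, so they converge to envelopes; compactness turns the limits
into a point `T x` (`exists_multiplier_at`). Envelopes are linear (`envelope_coneLinear`), hence so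
is `T`. Since `g` is bounded above and away from zero on `K`, a Neumann series inverts `T`
(`bijOn_of_bounds`).

If the extreme boundary is closed, envelopes are continuous on `K` (`continuousOn_envelope`), so `T`
is too, and the affine bijection of compact bases is a homeomorphism. -/

namespace SimplexCone

/-! ### Linear maps on cones and the coefficient functional of a base -/

/-- A map defined on the ambient space that is additive and positively homogeneous on a cone. -/
structure ConeLinear {E F : Type*} [AddCommGroup E] [Module ℝ E] [AddCommGroup F] [Module ℝ F]
    (C : PointedCone ℝ E) (h : E → F) : Prop where
  map_add : ∀ x ∈ C, ∀ y ∈ C, h (x + y) = h x + h y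
  map_smul : ∀ t : ℝ, 0 ≤ t → ∀ x ∈ C, h (t • x) = t • h x

namespace ConeLinear

variable {E F G : Type*} [AddCommGroup E] [Module ℝ E] [AddCommGroup F] [Module ℝ F]
  [AddCommGroup G] [Module ℝ G] {C : PointedCone ℝ E} {h h' : E → F}

theorem map_zero (hh : ConeLinear C h) : h 0 = 0 := by
  simpa using hh.map_smul 0 le_rfl 0 C.zero_mem

theorem add (hh : ConeLinear C h) (hh' : ConeLinear C h') :
    ConeLinear C (fun x => h x + h' x) where
  map_add x hx y hy := by rw [hh.map_add x hx y hy, hh'.map_add x hx y hy]; abel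
  map_smul t ht x hx := by rw [hh.map_smul t ht x hx, hh'.map_smul t ht x hx, smul_add]

theorem sub (hh : ConeLinear C h) (hh' : ConeLinear C h') :
    ConeLinear C (fun x => h x - h' x) where
  map_add x hx y hy := by rw [hh.map_add x hx y hy, hh'.map_add x hx y hy]; abel
  map_smul t ht x hx := by rw [hh.map_smul t ht x hx, hh'.map_smul t ht x hx, smul_sub]

theorem comp {D : PointedCone ℝ F} {k : F → G} (hk : ConeLinear D k) (hh : ConeLinear C h)
    (hm : ∀ x ∈ C, h x ∈ D) : ConeLinear C (fun x => k (h x)) where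
  map_add x hx y hy := by rw [hh.map_add x hx y hy, hk.map_add _ (hm x hx) _ (hm y hy)]
  map_smul t ht x hx := by rw [hh.map_smul t ht x hx, hk.map_smul t ht _ (hm x hx)]

theorem map_multiset_sum (hh : ConeLinear C h) (s : Multiset E) (hs : ∀ c ∈ s, c ∈ C) :
    h s.sum = (s.map h).sum := by
  induction s using Multiset.induction_on with
  | empty => simpa using hh.map_zero
  | cons a s ih =>
    have hs' : ∀ c ∈ s, c ∈ C := fun c hc => hs c (Multiset.mem_cons_of_mem hc)
    rw [Multiset.sum_cons, Multiset.map_cons, Multiset.sum_cons,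
      hh.map_add a (hs a (Multiset.mem_cons_self a s)) _ (C.toAddSubmonoid.multiset_sum_mem s hs'),
      ih hs']

theorem isAffine {D : Set F} {K : Set E} (hh : ConeLinear C h) (hK : K ⊆ C)
    (hm : ∀ x : K, h x ∈ D) : IsAffine (fun x : K => (⟨h x, hm x⟩ : D)) := by
  intro x y z a b ha hb _ hz
  simp only
  rw [hz, hh.map_add _ (PointedCone.smul_mem C ha (hK x.2)) _
    (PointedCone.smul_mem C hb (hK y.2)), hh.map_smul a ha _ (hK x.2), hh.map_smul b hb _ (hK y.2)]

end ConeLinear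

theorem _root_.ContinuousLinearMap.coneLinear {E : Type*} [AddCommGroup E] [Module ℝ E]
    [TopologicalSpace E] (C : PointedCone ℝ E) (l : E →L[ℝ] ℝ) : ConeLinear C (fun x => l x) where
  map_add x _ y _ := l.map_add x y
  map_smul t _ x _ := l.map_smul t x

open Classical in
/-- The coefficient `t` in the representation `c = t • k` of an element of a cone with
base `K`. -/
noncomputable def baseCoeff {E : Type*} [AddCommGroup E] [Module ℝ E] (K : Set E) (c : E) : ℝ :=
  if h : ∃ p : ℝ × E, 0 < p.1 ∧ p.2 ∈ K ∧ c = p.1 • p.2 then h.choose.1 else 0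

namespace IsBase

section Algebra

variable {E : Type*} [AddCommGroup E] [Module ℝ E] {C : PointedCone ℝ E} {K : Set E}

theorem subset (hK : IsBase C K) : K ⊆ C := hK.1

theorem convex (hK : IsBase C K) : Convex ℝ K := hK.2.1

theorem zero_notMem (hK : IsBase C K) : (0 : E) ∉ K := hK.2.2.1

theorem ne_zero (hK : IsBase C K) {k : E} (hk : k ∈ K) : k ≠ 0 :=
  fun h => hK.zero_notMem (h ▸ hk)

theorem baseCoeff_smul (hK : IsBase C K) {t : ℝ} (ht : 0 < t) {k : E} (hk : k ∈ K) :
    baseCoeff K (t • k) = t := by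
  have h : ∃ p : ℝ × E, 0 < p.1 ∧ p.2 ∈ K ∧ t • k = p.1 • p.2 := ⟨(t, k), ht, hk, rfl⟩
  rw [baseCoeff, dif_pos h]
  have hu := hK.2.2.2 (t • k) (PointedCone.smul_mem C ht.le (hK.subset hk))
    (smul_ne_zero ht.ne' (hK.ne_zero hk))
  exact congrArg Prod.fst (hu.unique h.choose_spec (y₂ := (t, k)) ⟨ht, hk, rfl⟩)

theorem baseCoeff_zero (hK : IsBase C K) : baseCoeff K 0 = 0 := by
  rw [baseCoeff, dif_neg]
  rintro ⟨p, hp, hpK, h⟩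
  exact smul_ne_zero hp.ne' (hK.ne_zero hpK) h.symm

theorem baseCoeff_eq_one (hK : IsBase C K) {k : E} (hk : k ∈ K) : baseCoeff K k = 1 := by
  simpa using hK.baseCoeff_smul one_pos hk

theorem exists_eq_smul (hK : IsBase C K) {c : E} (hc : c ∈ C) (h0 : c ≠ 0) :
    0 < baseCoeff K c ∧ ∃ k ∈ K, c = baseCoeff K c • k := by
  obtain ⟨⟨t, k⟩, ⟨ht, hk, rfl⟩, -⟩ := hK.2.2.2 c hc h0
  simp only at ht hk ⊢
  rw [hK.baseCoeff_smul ht hk]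
  exact ⟨ht, k, hk, rfl⟩

theorem baseCoeff_pos (hK : IsBase C K) {c : E} (hc : c ∈ C) (h0 : c ≠ 0) : 0 < baseCoeff K c :=
  (hK.exists_eq_smul hc h0).1

theorem baseCoeff_nonneg (hK : IsBase C K) {c : E} (hc : c ∈ C) : 0 ≤ baseCoeff K c := by
  rcases eq_or_ne c 0 with rfl | h0
  · rw [hK.baseCoeff_zero]
  · exact (hK.baseCoeff_pos hc h0).le

theorem inv_smul_mem (hK : IsBase C K) {c : E} (hc : c ∈ C) (h0 : c ≠ 0) :
    (baseCoeff K c)⁻¹ • c ∈ K := by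
  obtain ⟨hpos, k, hk, h⟩ := hK.exists_eq_smul hc h0
  have : (baseCoeff K c)⁻¹ • c = k := by
    conv_lhs => rw [h, hK.baseCoeff_smul hpos hk]
    rw [smul_smul, inv_mul_cancel₀ hpos.ne', one_smul]
  rwa [this]

theorem mem_of_baseCoeff_eq_one (hK : IsBase C K) {c : E} (hc : c ∈ C) (h : baseCoeff K c = 1) :
    c ∈ K := by
  have h0 : c ≠ 0 := by rintro rfl; rw [hK.baseCoeff_zero] at h; exact zero_ne_one h
  simpa [h] using hK.inv_smul_mem hc h0

theorem coneLinear (hK : IsBase C K) : ConeLinear C (baseCoeff K) := by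
  have hsmul : ∀ t : ℝ, 0 ≤ t → ∀ x ∈ C, baseCoeff K (t • x) = t • baseCoeff K x := by
    intro t ht x hx
    rcases ht.eq_or_lt with rfl | ht
    · simp [hK.baseCoeff_zero]
    rcases eq_or_ne x 0 with rfl | h0
    · simp [hK.baseCoeff_zero]
    obtain ⟨hpos, k, hk, h⟩ := hK.exists_eq_smul hx h0
    conv_lhs => rw [h, smul_smul]
    rw [hK.baseCoeff_smul (mul_pos ht hpos) hk, smul_eq_mul]
  refine ⟨?_, hsmul⟩
  intro x hx y hy
  rcases eq_or_ne x 0 with rfl | hx0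
  · simp [hK.baseCoeff_zero]
  rcases eq_or_ne y 0 with rfl | hy0
  · simp [hK.baseCoeff_zero]
  obtain ⟨ha, k, hk, hxk⟩ := hK.exists_eq_smul hx hx0
  obtain ⟨hb, l, hl, hyl⟩ := hK.exists_eq_smul hy hy0
  set a := baseCoeff K x
  set b := baseCoeff K y
  have hab : 0 < a + b := add_pos ha hb
  have hm : (a / (a + b)) • k + (b / (a + b)) • l ∈ K :=
    hK.convex hk hl (by positivity) (by positivity) (by field_simp)
  have : x + y = (a + b) • ((a / (a + b)) • k + (b / (a + b)) • l) := by
    rw [hxk, hyl, smul_add, smul_smul, smul_smul, mul_div_cancel₀ _ hab.ne',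
      mul_div_cancel₀ _ hab.ne']
  rw [this, hK.baseCoeff_smul hab hm]

/-- If an extreme point of a base is a sum in the cone, the summands are proportional to it. -/
theorem eq_smul_of_add_eq_extreme (hK : IsBase C K) {x a b : E} (hx : x ∈ K.extremePoints ℝ)
    (ha : a ∈ C) (hb : b ∈ C) (hab : a + b = x) : a = baseCoeff K a • x := by
  rcases eq_or_ne a 0 with rfl | ha0
  · simp [hK.baseCoeff_zero]
  rcases eq_or_ne b 0 with rfl | hb0
  · rw [add_zero] at hab
    subst hab
    rw [hK.baseCoeff_eq_one hx.1, one_smul]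
  obtain ⟨hpa, k, hk, hak⟩ := hK.exists_eq_smul ha ha0
  obtain ⟨hpb, l, hl, hbl⟩ := hK.exists_eq_smul hb hb0
  have h1 : baseCoeff K a + baseCoeff K b = 1 := by
    rw [← hK.coneLinear.map_add a ha b hb, hab, hK.baseCoeff_eq_one hx.1]
  have : k = x := hx.2 hk hl ⟨_, _, hpa, hpb, h1, by rw [← hak, ← hbl, hab]⟩
  rw [← this, ← hak]

/-- A point of a base that has only proportional summands in the cone is extreme. -/
theorem mem_extremePoints_of (hK : IsBase C K) {x : E} (hx : x ∈ K)
    (h : ∀ a ∈ C, ∀ b ∈ C, a + b = x → ∃ t : ℝ, a = t • x) : x ∈ K.extremePoints ℝ := by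
  refine ⟨hx, fun y hy z hz ⟨a, b, ha, hb, _, hyz⟩ => ?_⟩
  obtain ⟨t, ht⟩ := h (a • y) (PointedCone.smul_mem C ha.le (hK.subset hy)) (b • z)
    (PointedCone.smul_mem C hb.le (hK.subset hz)) hyz
  have hy' : y = (a⁻¹ * t) • x := by
    rw [mul_smul, ← ht, smul_smul, inv_mul_cancel₀ ha.ne', one_smul]
  have hpos : 0 < a⁻¹ * t := by
    by_contra hneg
    have h1 : (1 : ℝ) • y + (-(a⁻¹ * t)) • x = 0 := by
      rw [one_smul]; nth_rewrite 1 [hy']; rw [← add_smul]; simp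
    have h2 := hK.coneLinear.map_add ((1 : ℝ) • y) (PointedCone.smul_mem C zero_le_one
      (hK.subset hy)) ((-(a⁻¹ * t)) • x) (PointedCone.smul_mem C (by linarith) (hK.subset hx))
    rw [h1, hK.baseCoeff_zero, one_smul, hK.baseCoeff_eq_one hy,
      hK.coneLinear.map_smul _ (by linarith) x (hK.subset hx), hK.baseCoeff_eq_one hx] at h2
    simp only [smul_eq_mul] at h2
    linarith
  have h1 := hK.baseCoeff_smul hpos hx
  rw [← hy', hK.baseCoeff_eq_one hy] at h1
  rw [hy', ← h1, one_smul]

end Algebra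

/-! ### Compactness and continuity for compact bases -/

section Topology

variable {E : Type*} [AddCommGroup E] [Module ℝ E] [TopologicalSpace E]
  [ContinuousSMul ℝ E] {C : PointedCone ℝ E} {K : Set E}

/-- The graph is the image of `[0, a] × K` under `(t, k) ↦ (t • k, t)`, together with the apex,
which the image misses when `K` is empty. From it come the compact sublevel and level sets in which
limits are found. -/
theorem isCompact_graph (hK : IsBase C K) (hcK : IsCompact K) (a : ℝ) :
    IsCompact {p : E × ℝ | p.1 ∈ C ∧ p.2 = baseCoeff K p.1 ∧ p.2 ≤ a} := by
  rcases lt_or_ge a 0 with ha | ha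
  · convert isCompact_empty (X := E × ℝ)
    refine Set.eq_empty_iff_forall_notMem.2 fun p ⟨h1, h2, h3⟩ => ?_
    linarith [hK.baseCoeff_nonneg h1]
  have hc : IsCompact (((fun q : ℝ × E => (q.1 • q.2, q.1)) '' (Set.Icc 0 a ×ˢ K)) ∪
      {((0 : E), (0 : ℝ))}) :=
    ((isCompact_Icc.prod hcK).image (by fun_prop)).union isCompact_singleton
  convert hc using 1
  ext ⟨c, t⟩
  simp only [Set.mem_ofPred_eq, Set.mem_union, Set.mem_image, Set.mem_prod, Prod.exists,
    Prod.mk.injEq, Set.mem_singleton_iff, Set.mem_Icc]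
  constructor
  · rintro ⟨hc, rfl, hle⟩
    rcases eq_or_ne c 0 with rfl | h0
    · exact Or.inr ⟨rfl, hK.baseCoeff_zero⟩
    · obtain ⟨hp, k, hk, h⟩ := hK.exists_eq_smul hc h0
      exact Or.inl ⟨_, k, ⟨⟨hp.le, hle⟩, hk⟩, h.symm, rfl⟩
  · rintro (⟨s, k, ⟨⟨h0, h1⟩, hk⟩, rfl, rfl⟩ | ⟨rfl, rfl⟩)
    · refine ⟨PointedCone.smul_mem C h0 (hK.subset hk), ?_, h1⟩
      rw [hK.coneLinear.map_smul _ h0 _ (hK.subset hk), hK.baseCoeff_eq_one hk, smul_eq_mul,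
        mul_one]
    · exact ⟨C.zero_mem, hK.baseCoeff_zero.symm, ha⟩

theorem isCompact_sublevel (hK : IsBase C K) (hcK : IsCompact K) (a : ℝ) :
    IsCompact {c : E | c ∈ C ∧ baseCoeff K c ≤ a} := by
  convert (hK.isCompact_graph hcK a).image continuous_fst using 1
  ext c
  simp

theorem isCompact_level (hK : IsBase C K) (hcK : IsCompact K) (a : ℝ) :
    IsCompact {c : E | c ∈ C ∧ baseCoeff K c = a} := by
  convert ((hK.isCompact_graph hcK a).inter_right
    ((isClosed_singleton (x := a)).preimage continuous_snd)).image continuous_fst using 1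
  ext c
  simp only [Set.mem_ofPred_eq, Set.mem_image, Set.mem_inter_iff, Set.mem_preimage,
    Set.mem_singleton_iff, Prod.exists, exists_and_right, exists_eq_right]
  constructor
  · rintro ⟨h, rfl⟩; exact ⟨h, rfl, le_rfl⟩
  · rintro ⟨h, rfl, -⟩; exact ⟨h, rfl⟩

omit [ContinuousSMul ℝ E] in
theorem exists_bound (hK : IsBase C K) (hcK : IsCompact K) {h : E → ℝ} (hh : ConeLinear C h)
    (hcont : ContinuousOn h K) : ∃ B : ℝ, 0 ≤ B ∧ ∀ c ∈ C, |h c| ≤ B * baseCoeff K c := by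
  obtain ⟨B, hB⟩ := hcK.exists_bound_of_continuousOn hcont
  refine ⟨max B 0, le_max_right _ _, fun c hc => ?_⟩
  rcases eq_or_ne c 0 with rfl | h0
  · simp [hh.map_zero, hK.baseCoeff_zero]
  · obtain ⟨hp, k, hk, hck⟩ := hK.exists_eq_smul hc h0
    have : h c = baseCoeff K c * h k := by
      conv_lhs => rw [hck]
      rw [hh.map_smul _ hp.le _ (hK.subset hk), smul_eq_mul]
    rw [this, abs_mul, abs_of_pos hp, mul_comm]
    exact mul_le_mul_of_nonneg_right ((hB k hk).trans (le_max_left _ _)) hp.le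

end Topology

section LocallyConvex

variable {E : Type*} [AddCommGroup E] [Module ℝ E] [TopologicalSpace E] [IsTopologicalAddGroup E]
  [ContinuousSMul ℝ E] [LocallyConvexSpace ℝ E] [T2Space E] {C : PointedCone ℝ E} {K : Set E}

/-- Hahn–Banach separates `0` from `K` by some `l` with `l > r > 0` on `K`, so the coefficient is at
most `l / r` on the cone. -/
theorem bddAbove_baseCoeff (hK : IsBase C K) (hcK : IsCompact K) {A : Set E} (hA : IsCompact A)
    (hAC : A ⊆ C) : ∃ R : ℝ, ∀ c ∈ A, baseCoeff K c ≤ R := by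
  obtain ⟨l, r, hr0, hr⟩ := geometric_hahn_banach_point_closed hK.convex hcK.isClosed
    hK.zero_notMem
  rw [map_zero] at hr0
  obtain ⟨M, hM⟩ := hA.exists_bound_of_continuousOn (f := fun x => l x) l.continuous.continuousOn
  refine ⟨M / r, fun c hc => ?_⟩
  rcases eq_or_ne c 0 with rfl | h0
  · rw [hK.baseCoeff_zero]
    exact div_nonneg ((norm_nonneg _).trans (hM 0 hc)) hr0.le
  · obtain ⟨hp, k, hk, h⟩ := hK.exists_eq_smul (hAC hc) h0
    rw [le_div_iff₀ hr0]
    have h1 : l c = baseCoeff K c * l k := by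
      conv_lhs => rw [h]
      simp
    have h2 := (le_abs_self _).trans (hM c hc)
    have h3 := mul_lt_mul_of_pos_left (hr k hk) hp
    linarith

/-- On a compact set the coefficient is bounded, and a function whose graph lies in a compact graph
is continuous. -/
theorem continuousOn_baseCoeff (hK : IsBase C K) (hcK : IsCompact K) {A : Set E}
    (hA : IsCompact A) (hAC : A ⊆ C) : ContinuousOn (baseCoeff K) A := by
  obtain ⟨R, hR⟩ := hK.bddAbove_baseCoeff hcK hA hAC
  rw [continuousOn_iff_isClosed]
  intro t ht
  refine ⟨Prod.fst '' ({p : E × ℝ | p.1 ∈ C ∧ p.2 = baseCoeff K p.1 ∧ p.2 ≤ R} ∩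
    Prod.snd ⁻¹' t), (((hK.isCompact_graph hcK R).inter_right
      (ht.preimage continuous_snd)).image continuous_fst).isClosed, ?_⟩
  ext c
  constructor
  · rintro ⟨h1, h2⟩
    exact ⟨⟨(c, baseCoeff K c), ⟨⟨hAC h2, rfl, hR c h2⟩, h1⟩, rfl⟩, h2⟩
  · rintro ⟨⟨⟨c', s⟩, ⟨⟨h1, h2, h3⟩, h4⟩, rfl⟩, h5⟩
    simp only [Set.mem_preimage] at h4 h2
    exact ⟨by rw [Set.mem_preimage, ← h2]; exact h4, h5⟩

end LocallyConvex

end IsBase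

end SimplexCone

/-! ### Riesz decomposition and the Choquet order -/

namespace SimplexCone

/-- Riesz decomposition: two representations of an element as a sum of two elements of a lattice
cone have a common refinement. -/
theorem IsLatticeCone.riesz {E : Type*} [AddCommGroup E] [Module ℝ E] {C : PointedCone ℝ E}
    (hC : IsLatticeCone C) {a b c d : E} (ha : a ∈ C) (hb : b ∈ C) (hc : c ∈ C) (hd : d ∈ C)
    (h : a + b = c + d) : ∃ p ∈ C, ∃ q ∈ C, ∃ r ∈ C, ∃ s ∈ C,
      a = p + q ∧ b = r + s ∧ c = p + r ∧ d = q + s := by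
  obtain ⟨⟨z, -, hza, hzc, hz⟩, -⟩ := hC.2 a ha c hc
  -- Here `z` is the supremum of `a` and `c`, so `a + c - z` is their infimum. Both `a + c` and `a +
  -- b = c + d` are upper bounds, hence dominate `z`.
  refine ⟨a + c - z, hz _ (C.add_mem ha hc) (by simpa using hc) (by simpa using ha), z - c, hzc,
    z - a, hza, a + b - z, hz _ (C.add_mem ha hb) (by simpa using hb) ?_, by abel, by abel, by abel,
    ?_⟩
  · rw [h]; simpa using hd
  · rw [h]; abel

/-- Subadditivity on a cone, normalized at `0`. -/
def IsSubadditive {E : Type*} [AddCommGroup E] [Module ℝ E] (C : PointedCone ℝ E)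
    (q : E → ℝ) : Prop :=
  q 0 = 0 ∧ ∀ a ∈ C, ∀ b ∈ C, q (a + b) ≤ q a + q b

theorem IsSubadditive.map_sum_le {E : Type*} [AddCommGroup E] [Module ℝ E]
    {C : PointedCone ℝ E} {q : E → ℝ} (hq : IsSubadditive C q) (t : Multiset E) :
    (∀ c ∈ t, c ∈ C) → q t.sum ≤ (t.map q).sum := by
  induction t using Multiset.induction_on with
  | empty => intro _; simp [hq.1]
  | cons c t ih =>
    intro ht
    have ht' : ∀ c ∈ t, c ∈ C := fun d hd => ht d (Multiset.mem_cons_of_mem hd)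
    have := ih ht'
    have := hq.2 c (ht c (Multiset.mem_cons_self c t)) t.sum
      (C.toAddSubmonoid.multiset_sum_mem t ht')
    simp only [Multiset.map_cons, Multiset.sum_cons]
    linarith

/-- The decompositions of `x` as a finite sum of elements of the cone `C`. -/
def Decomposition {E : Type*} [AddCommGroup E] [Module ℝ E] (C : PointedCone ℝ E) (x : E) :=
  {s : Multiset E // (∀ c ∈ s, c ∈ C) ∧ s.sum = x}

section Decomposition

variable {E : Type*} [AddCommGroup E] [Module ℝ E] {C : PointedCone ℝ E}

/-- The Choquet order on decompositions: the sums of every subadditive function increase. -/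
instance (x : E) : Preorder (Decomposition C x) where
  le s t := ∀ q : E → ℝ, IsSubadditive C q → (s.1.map q).sum ≤ (t.1.map q).sum
  le_refl _ _ _ := le_rfl
  le_trans _ _ _ h1 h2 q hq := (h1 q hq).trans (h2 q hq)

/-- A sum decomposes along a decomposition of the total. -/
theorem exists_split (hC : IsLatticeCone C) (t : Multiset E) (ht : ∀ c ∈ t, c ∈ C) :
    ∀ a ∈ C, ∀ b ∈ C, t.sum = a + b → ∃ (ta : Decomposition C a) (tb : Decomposition C b),
      ∀ q : E → ℝ, IsSubadditive C q → (t.map q).sum ≤ (ta.1.map q).sum + (tb.1.map q).sum := by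
  induction t using Multiset.induction_on with
  | empty =>
    intro a ha b hb h
    rw [Multiset.sum_zero] at h
    have ha0 : a = 0 := hC.1 a ha (by rwa [neg_eq_of_add_eq_zero_right h.symm])
    have hb0 : b = 0 := by rw [ha0, zero_add] at h; exact h.symm
    exact ⟨⟨0, by simp, by simp [ha0]⟩, ⟨0, by simp, by simp [hb0]⟩, fun q _ => by simp⟩
  | cons c t ih =>
    intro a ha b hb h
    have hc : c ∈ C := ht c (Multiset.mem_cons_self c t)
    have ht' : ∀ c ∈ t, c ∈ C := fun d hd => ht d (Multiset.mem_cons_of_mem hd)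
    rw [Multiset.sum_cons] at h
    obtain ⟨p, hp, r, hr, a', ha', b', hb', h1, h2, h3, h4⟩ :=
      hC.riesz hc (C.toAddSubmonoid.multiset_sum_mem t ht') ha hb h
    obtain ⟨ta, tb, hq⟩ := ih ht' a' ha' b' hb' h2
    refine ⟨⟨p ::ₘ ta.1, ?_, ?_⟩, ⟨r ::ₘ tb.1, ?_, ?_⟩, fun q hq' => ?_⟩
    · intro d hd
      rcases Multiset.mem_cons.1 hd with rfl | hd
      exacts [hp, ta.2.1 d hd]
    · rw [Multiset.sum_cons, ta.2.2, h3]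
    · intro d hd
      rcases Multiset.mem_cons.1 hd with rfl | hd
      exacts [hr, tb.2.1 d hd]
    · rw [Multiset.sum_cons, tb.2.2, h4]
    · have e1 := hq q hq'
      have e2 := hq'.2 p hp r hr
      simp only [Multiset.map_cons, Multiset.sum_cons]
      rw [h1]
      linarith

/-- Split `t` along `a` and the sum of the remaining terms of `s`: the first part refines `a`, and
the second has a common refinement with the remaining terms by induction. -/
theorem exists_common_refinement (hC : IsLatticeCone C) (s : Multiset E) :
    ∀ t : Multiset E, (∀ c ∈ s, c ∈ C) → (∀ c ∈ t, c ∈ C) → s.sum = t.sum →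
      ∃ w : Decomposition C s.sum, ∀ q : E → ℝ, IsSubadditive C q →
        (s.map q).sum ≤ (w.1.map q).sum ∧ (t.map q).sum ≤ (w.1.map q).sum := by
  induction s using Multiset.induction_on with
  | empty =>
    intro t _ ht h
    refine ⟨⟨t, ht, h.symm⟩, fun q hq => ⟨?_, le_rfl⟩⟩
    simpa [← h, hq.1] using hq.map_sum_le t ht
  | cons a s ih =>
    intro t hs ht h
    have ha : a ∈ C := hs a (Multiset.mem_cons_self a s)
    have hs' : ∀ c ∈ s, c ∈ C := fun d hd => hs d (Multiset.mem_cons_of_mem hd)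
    rw [Multiset.sum_cons] at h
    obtain ⟨ta, tb, hq⟩ := exists_split hC t ht a ha s.sum
      (C.toAddSubmonoid.multiset_sum_mem s hs') h.symm
    obtain ⟨w, hw⟩ := ih tb.1 hs' tb.2.1 tb.2.2.symm
    refine ⟨⟨ta.1 + w.1, ?_, ?_⟩, fun q hq' => ?_⟩
    · intro d hd
      rcases Multiset.mem_add.1 hd with hd | hd
      exacts [ta.2.1 d hd, w.2.1 d hd]
    · rw [Multiset.sum_add, Multiset.sum_cons, ta.2.2, w.2.2]
    · obtain ⟨e1, e2⟩ := hw q hq'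
      have e3 := hq q hq'
      have e4 : q a ≤ (ta.1.map q).sum := by simpa [ta.2.2] using hq'.map_sum_le ta.1 ta.2.1
      simp only [Multiset.map_cons, Multiset.sum_cons, Multiset.map_add, Multiset.sum_add]
      exact ⟨by linarith, by linarith⟩

theorem Decomposition.isDirectedOrder (hC : IsLatticeCone C) (x : E) :
    IsDirectedOrder (Decomposition C x) where
  directed s t := by
    obtain ⟨w, hw⟩ := exists_common_refinement hC s.1 t.1 s.2.1 t.2.1 (by rw [s.2.2, t.2.2])
    exact ⟨⟨w.1, w.2.1, w.2.2.trans s.2.2⟩, fun q hq => (hw q hq).1, fun q hq => (hw q hq).2⟩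

theorem Decomposition.nonempty {x : E} (hx : x ∈ C) : Nonempty (Decomposition C x) :=
  ⟨⟨{x}, by simpa using hx, by simp⟩⟩

end Decomposition

/-! ### Energies and their envelopes -/

/-- The perspective `h² / f` of the square of `h`, where `f` is the coefficient function
of `K`. -/
noncomputable def energy {E : Type*} [AddCommGroup E] [Module ℝ E] (K : Set E) (h : E → ℝ)
    (c : E) : ℝ :=
  h c ^ 2 / baseCoeff K c

/-- The supremum over all decompositions of `x` of the total energy of `h`. -/
noncomputable def envelope {E : Type*} [AddCommGroup E] [Module ℝ E] (C : PointedCone ℝ E)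
    (K : Set E) (h : E → ℝ) (x : E) : ℝ :=
  ⨆ D : Decomposition C x, (D.1.map (energy K h)).sum

section Envelope

variable {E : Type*} [AddCommGroup E] [Module ℝ E] {C : PointedCone ℝ E} {K : Set E} {h : E → ℝ}
  {B : ℝ}

/-- With denominators cleared, the inequality is `(h a * f b - h b * f a)² ≥ 0`, where `f` is the
coefficient functional. At the apex, division by zero gives the right value `0`. -/
theorem energy_isSubadditive (hK : IsBase C K) (hh : ConeLinear C h) :
    IsSubadditive C (energy K h) := by
  refine ⟨by simp [energy, hK.baseCoeff_zero], fun a ha b hb => ?_⟩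
  rcases eq_or_ne a 0 with rfl | ha0
  · simp [energy, hK.baseCoeff_zero]
  rcases eq_or_ne b 0 with rfl | hb0
  · simp [energy, hK.baseCoeff_zero]
  have hfa := hK.baseCoeff_pos ha ha0
  have hfb := hK.baseCoeff_pos hb hb0
  simp only [energy]
  rw [hh.map_add a ha b hb, hK.coneLinear.map_add a ha b hb, div_add_div _ _ hfa.ne' hfb.ne',
    div_le_div_iff₀ (by positivity) (by positivity)]
  have := sq_nonneg (h a * baseCoeff K b - h b * baseCoeff K a)
  nlinarith

theorem energy_le (hK : IsBase C K) (hB : ∀ c ∈ C, |h c| ≤ B * baseCoeff K c) {c : E}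
    (hc : c ∈ C) : energy K h c ≤ B ^ 2 * baseCoeff K c := by
  rcases eq_or_ne c 0 with rfl | h0
  · simp [energy, hK.baseCoeff_zero]
  · have hp := hK.baseCoeff_pos hc h0
    rw [energy, div_le_iff₀ hp]
    have := sq_le_sq' (abs_le.1 (hB c hc)).1 (abs_le.1 (hB c hc)).2
    nlinarith

theorem sum_energy_le (hK : IsBase C K) (hB : ∀ c ∈ C, |h c| ≤ B * baseCoeff K c) {x : E}
    (D : Decomposition C x) : (D.1.map (energy K h)).sum ≤ B ^ 2 * baseCoeff K x := by
  have h1 := Multiset.sum_map_le_sum_map (s := D.1) (energy K h)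
    (fun c => B ^ 2 * baseCoeff K c) (fun c hc => energy_le hK hB (D.2.1 c hc))
  rwa [Multiset.sum_map_mul_left, ← hK.coneLinear.map_multiset_sum D.1 D.2.1, D.2.2] at h1

theorem bddAbove_sum_energy (hK : IsBase C K) (hB : ∀ c ∈ C, |h c| ≤ B * baseCoeff K c) (x : E) :
    BddAbove (Set.range fun D : Decomposition C x => (D.1.map (energy K h)).sum) :=
  ⟨B ^ 2 * baseCoeff K x, by rintro _ ⟨D, rfl⟩; exact sum_energy_le hK hB D⟩

theorem sum_energy_le_envelope (hK : IsBase C K) (hB : ∀ c ∈ C, |h c| ≤ B * baseCoeff K c)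
    {x : E} (D : Decomposition C x) : (D.1.map (energy K h)).sum ≤ envelope C K h x :=
  le_ciSup (bddAbove_sum_energy hK hB x) D

theorem energy_le_envelope (hK : IsBase C K) (hB : ∀ c ∈ C, |h c| ≤ B * baseCoeff K c)
    {x : E} (hx : x ∈ C) : energy K h x ≤ envelope C K h x := by
  simpa using sum_energy_le_envelope hK hB (x := x) ⟨{x}, by simpa using hx, by simp⟩

/-- A decomposition of `x + y` splits along `x` and `y` without loss of energy; conversely,
decompositions of `x` and `y` can be concatenated. -/
theorem envelope_add (hC : IsLatticeCone C) (hK : IsBase C K) (hh : ConeLinear C h)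
    (hB : ∀ c ∈ C, |h c| ≤ B * baseCoeff K c) {x y : E} (hx : x ∈ C) (hy : y ∈ C) :
    envelope C K h (x + y) = envelope C K h x + envelope C K h y := by
  have := Decomposition.nonempty hx
  have := Decomposition.nonempty hy
  have := Decomposition.nonempty (C.add_mem hx hy)
  apply le_antisymm
  · refine ciSup_le fun D => ?_
    obtain ⟨s, t, hst⟩ := exists_split hC D.1 D.2.1 x hx y hy D.2.2
    exact (hst _ (energy_isSubadditive hK hh)).trans
      (add_le_add (sum_energy_le_envelope hK hB s) (sum_energy_le_envelope hK hB t))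
  · rw [← le_sub_iff_add_le]
    refine ciSup_le fun s => ?_
    rw [le_sub_comm]
    refine ciSup_le fun t => ?_
    rw [le_sub_iff_add_le, add_comm]
    have := sum_energy_le_envelope hK hB (x := x + y) ⟨s.1 + t.1, fun c hc =>
      (Multiset.mem_add.1 hc).elim (s.2.1 c) (t.2.1 c), by rw [Multiset.sum_add, s.2.2, t.2.2]⟩
    simpa using this

theorem energy_smul (hK : IsBase C K) (hh : ConeLinear C h) {t : ℝ} (ht : 0 < t) {c : E}
    (hc : c ∈ C) : energy K h (t • c) = t * energy K h c := by
  rw [energy, energy, hh.map_smul t ht.le c hc, hK.coneLinear.map_smul t ht.le c hc]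
  simp only [smul_eq_mul]
  rcases eq_or_ne (baseCoeff K c) 0 with h0 | h0
  · simp [h0]
  · field_simp

theorem envelope_coneLinear (hC : IsLatticeCone C) (hK : IsBase C K) (hh : ConeLinear C h)
    (hB : ∀ c ∈ C, |h c| ≤ B * baseCoeff K c) : ConeLinear C (envelope C K h) := by
  refine ⟨fun x hx y hy => envelope_add hC hK hh hB hx hy, fun t ht x hx => ?_⟩
  rcases ht.eq_or_lt with rfl | ht
  · have := envelope_add hC hK hh hB C.zero_mem C.zero_mem
    rw [add_zero] at this
    simp only [zero_smul]
    linarith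
  -- Scaling a decomposition scales its energy. This gives one inequality; the other is the same one
  -- for `t⁻¹`.
  have key : ∀ t : ℝ, 0 < t → ∀ x ∈ C, t * envelope C K h x ≤ envelope C K h (t • x) := by
    intro t ht x hx
    have := Decomposition.nonempty hx
    rw [mul_comm, ← le_div_iff₀ ht]
    refine ciSup_le fun D => ?_
    rw [le_div_iff₀ ht, mul_comm]
    have := sum_energy_le_envelope hK hB (x := t • x) ⟨D.1.map (t • ·), ?_, ?_⟩
    · rw [Multiset.map_map] at this
      rw [← Multiset.sum_map_mul_left]
      refine le_of_eq_of_le ?_ this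
      refine congrArg Multiset.sum (Multiset.map_congr rfl fun c hc => ?_)
      exact (energy_smul hK hh ht (D.2.1 c hc)).symm
    · intro c hc
      obtain ⟨d, hd, rfl⟩ := Multiset.mem_map.1 hc
      exact PointedCone.smul_mem C ht.le (D.2.1 d hd)
    · rw [← Multiset.smul_sum, D.2.2]
  refine le_antisymm ?_ (key t ht x hx)
  have := key t⁻¹ (inv_pos.2 ht) (t • x) (PointedCone.smul_mem C ht.le hx)
  rw [smul_smul, inv_mul_cancel₀ ht.ne', one_smul, inv_mul_le_iff₀ ht] at this
  exact this

theorem Decomposition.mem_eq_smul (hK : IsBase C K) {x : E} (hx : x ∈ K.extremePoints ℝ)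
    (D : Decomposition C x) {c : E} (hc : c ∈ D.1) : c = baseCoeff K c • x := by
  obtain ⟨s, hs⟩ := Multiset.exists_cons_of_mem hc
  have hsC : ∀ d ∈ s, d ∈ C := fun d hd => D.2.1 d (hs ▸ Multiset.mem_cons_of_mem hd)
  refine hK.eq_smul_of_add_eq_extreme hx (D.2.1 c hc) (C.toAddSubmonoid.multiset_sum_mem s hsC) ?_
  rw [← D.2.2, hs, Multiset.sum_cons]

/-- An extreme point decomposes only into multiples of itself, so all its decompositions have the
same energy. -/
theorem envelope_extreme (hK : IsBase C K) (hh : ConeLinear C h) {x : E}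
    (hx : x ∈ K.extremePoints ℝ) : envelope C K h x = h x ^ 2 := by
  have := Decomposition.nonempty (hK.subset hx.1)
  have : ∀ D : Decomposition C x, (D.1.map (energy K h)).sum = h x ^ 2 := by
    intro D
    have h1 : D.1.map (energy K h) = D.1.map (fun c => h x ^ 2 * baseCoeff K c) := by
      refine Multiset.map_congr rfl fun c hc => ?_
      have hcC := D.2.1 c hc
      have : h c = baseCoeff K c * h x := by
        conv_lhs => rw [D.mem_eq_smul hK hx hc]
        rw [hh.map_smul _ (hK.baseCoeff_nonneg hcC) _ (hK.subset hx.1), smul_eq_mul]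
      rw [energy, this]
      rcases eq_or_ne (baseCoeff K c) 0 with h0 | h0
      · simp [h0]
      · field_simp
    rw [h1, Multiset.sum_map_mul_left, ← hK.coneLinear.map_multiset_sum D.1 D.2.1, D.2.2,
      hK.baseCoeff_eq_one hx.1, mul_one]
  simp [envelope, this]

theorem tendsto_sum_energy (hK : IsBase C K)
    (hh : ConeLinear C h) (hB : ∀ c ∈ C, |h c| ≤ B * baseCoeff K c) (x : E) :
    Filter.Tendsto (fun D : Decomposition C x => (D.1.map (energy K h)).sum) Filter.atTop
      (nhds (envelope C K h x)) :=
  tendsto_atTop_ciSup (fun _ _ hst => hst _ (energy_isSubadditive hK hh))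
    (bddAbove_sum_energy hK hB x)

end Envelope

/-! ### Multiplication by a function on the extreme boundary, pointwise -/

section Multiplier

open Filter Topology

variable {E : Type*} [AddCommGroup E] [Module ℝ E] [TopologicalSpace E] [IsTopologicalAddGroup E]
  [ContinuousSMul ℝ E] [LocallyConvexSpace ℝ E] [T2Space E] {C : PointedCone ℝ E} {K : Set E}
  {g : E → ℝ} {M : ℝ}

omit [LocallyConvexSpace ℝ E] in
/-- Multiplication by the restriction of `g` to the extreme boundary of `K`, at one point. -/
theorem exists_multiplier_at (hC : IsLatticeCone C) (hK : IsBase C K) (hcK : IsCompact K)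
    (hg : ConeLinear C g) (hgc : ContinuousOn g K) (hg0 : ∀ c ∈ C, 0 ≤ g c)
    (hgM : ∀ c ∈ C, g c ≤ M * baseCoeff K c) {x : E} (hx : x ∈ C) :
    ∃ z : E, z ∈ C ∧ baseCoeff K z = g x ∧ M • x - z ∈ C ∧ ∀ l : E →L[ℝ] ℝ,
      l z = (envelope C K (fun c => l c + g c) x - envelope C K (fun c => l c - g c) x) / 4 := by
  have := Decomposition.isDirectedOrder hC x
  have := Decomposition.nonempty hx
  let w : E → E := fun c => (g c / baseCoeff K c) • c
  let w' : E → E := fun c => (M - g c / baseCoeff K c) • c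
  have hwC : ∀ c ∈ C, w c ∈ C := fun c hc =>
    PointedCone.smul_mem C (div_nonneg (hg0 c hc) (hK.baseCoeff_nonneg hc)) hc
  have hw'C : ∀ c ∈ C, w' c ∈ C := fun c hc => by
    rcases eq_or_ne c 0 with rfl | h0
    · simp [w']
    · exact PointedCone.smul_mem C (sub_nonneg.2 ((div_le_iff₀ (hK.baseCoeff_pos hc h0)).2
        (hgM c hc))) hc
  have hfw : ∀ c ∈ C, baseCoeff K (w c) = g c := fun c hc => by
    rcases eq_or_ne c 0 with rfl | h0
    · simp [w, hK.baseCoeff_zero, hg.map_zero]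
    · rw [hK.coneLinear.map_smul _ (div_nonneg (hg0 c hc) (hK.baseCoeff_nonneg hc)) c hc,
        smul_eq_mul, div_mul_cancel₀ _ (hK.baseCoeff_pos hc h0).ne']
  -- `S D` approximates the desired point: each piece of the decomposition is multiplied by the
  -- value of `g` at its normalization in `K`.
  let S : Decomposition C x → E := fun D => (D.1.map w).sum
  have hSC : ∀ D, S D ∈ C := fun D => C.toAddSubmonoid.multiset_sum_mem _ fun c hc => by
    obtain ⟨d, hd, rfl⟩ := Multiset.mem_map.1 hc
    exact hwC d (D.2.1 d hd)
  have hS'C : ∀ D, M • x - S D ∈ C := fun D => by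
    have : M • x - S D = (D.1.map w').sum := by
      simp only [w', sub_smul, S, w, Multiset.sum_map_sub]
      rw [← Multiset.smul_sum, D.2.2]
    rw [this]
    refine C.toAddSubmonoid.multiset_sum_mem _ fun c hc => ?_
    obtain ⟨d, hd, rfl⟩ := Multiset.mem_map.1 hc
    exact hw'C d (D.2.1 d hd)
  have hfS : ∀ D, baseCoeff K (S D) = g x := fun D => by
    rw [hK.coneLinear.map_multiset_sum, Multiset.map_map]
    · rw [← congrArg g D.2.2, hg.map_multiset_sum D.1 D.2.1]
      exact congrArg Multiset.sum (Multiset.map_congr rfl fun c hc => hfw c (D.2.1 c hc))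
    · intro c hc
      obtain ⟨d, hd, rfl⟩ := Multiset.mem_map.1 hc
      exact hwC d (D.2.1 d hd)
  -- Polarization, `4 l g = (l + g)² - (l - g)²`, makes `l (S D)` a difference of two sums that
  -- increase along the Choquet order.
  have hlS : ∀ (l : E →L[ℝ] ℝ) (D : Decomposition C x), l (S D) =
      ((D.1.map (energy K fun c => l c + g c)).sum -
        (D.1.map (energy K fun c => l c - g c)).sum) / 4 := fun l D => by
    rw [← Multiset.sum_map_sub, ← Multiset.sum_map_div, map_multiset_sum, Multiset.map_map]
    refine congrArg Multiset.sum (Multiset.map_congr rfl fun c hc => ?_)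
    simp only [energy, w, Function.comp, map_smul, smul_eq_mul]
    ring
  -- All `S D` have coefficient `g x`, so they lie in a compact level set and converge along an
  -- ultrafilter finer than `atTop`.
  obtain ⟨z, hz, hlim⟩ := (hK.isCompact_level hcK (g x)).ultrafilter_le_nhds
    ((Ultrafilter.of (atTop : Filter (Decomposition C x))).map S) (by
      rw [le_principal_iff, Ultrafilter.mem_coe, Ultrafilter.mem_map]
      exact Filter.univ_mem' fun D => ⟨hSC D, hfS D⟩)
  have hlim : Tendsto S (Ultrafilter.of (atTop : Filter (Decomposition C x)) : Filter _) (𝓝 z) :=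
    hlim
  refine ⟨z, hz.1, hz.2, ?_, fun l => ?_⟩
  -- The coefficient of `M • x - S D` does not depend on `D`, so all these points lie in one
  -- compact, hence closed, sublevel set of `C`, and so does the limit.
  · refine ((hK.isCompact_sublevel hcK
      (baseCoeff K (M • x - S (Classical.arbitrary _)))).isClosed.mem_of_tendsto (tendsto_const_nhds.sub hlim) (Eventually.of_forall fun D => ⟨hS'C D, ?_⟩)).1
    have h1 : ∀ D, baseCoeff K (M • x) = baseCoeff K (M • x - S D) + g x := fun D => by
      rw [← hfS D, ← hK.coneLinear.map_add _ (hS'C D) _ (hSC D), sub_add_cancel]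
    linarith [h1 D, h1 (Classical.arbitrary _)]
  · obtain ⟨B₁, -, hB₁⟩ := hK.exists_bound hcK ((l.coneLinear C).add hg)
      (l.continuous.continuousOn.add hgc)
    obtain ⟨B₂, -, hB₂⟩ := hK.exists_bound hcK ((l.coneLinear C).sub hg)
      (l.continuous.continuousOn.sub hgc)
    have h1 := (tendsto_sum_energy hK ((l.coneLinear C).add hg) hB₁ x).mono_left
      (Ultrafilter.of_le atTop)
    have h2 := (tendsto_sum_energy hK ((l.coneLinear C).sub hg) hB₂ x).mono_left
      (Ultrafilter.of_le atTop)
    refine tendsto_nhds_unique ((l.continuous.tendsto z).comp hlim) ?_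
    refine ((h1.sub h2).div_const 4).congr fun D => ?_
    exact (hlS l D).symm

end Multiplier

end SimplexCone

/-! ### Inversion by a Neumann series -/

namespace SimplexCone

open Filter Topology

variable {E : Type*} [AddCommGroup E] [Module ℝ E] [TopologicalSpace E] [IsTopologicalAddGroup E]
  [ContinuousSMul ℝ E] [LocallyConvexSpace ℝ E] [T2Space E] {C : PointedCone ℝ E} {K : Set E}

theorem eq_of_forall_continuousLinearMap {a b : E} (h : ∀ l : E →L[ℝ] ℝ, l a = l b) : a = b := by
  by_contra hab
  obtain ⟨l, hl⟩ := geometric_hahn_banach_point_point hab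
  exact hl.ne (h l)

/-- Two points are equal if their difference is a difference of arbitrarily small elements of a
cone with compact base. -/
theorem eq_of_sub_eq_small (hK : IsBase C K) (hcK : IsCompact K) {a b : E} {p q : ℕ → E}
    (hp : ∀ n, p n ∈ C) (hq : ∀ n, q n ∈ C) (h : ∀ n, a - b = p n - q n)
    (hpl : Tendsto (fun n => baseCoeff K (p n)) atTop (𝓝 0))
    (hql : Tendsto (fun n => baseCoeff K (q n)) atTop (𝓝 0)) : a = b := by
  refine eq_of_forall_continuousLinearMap fun l => sub_eq_zero.1 ?_
  obtain ⟨B, hB0, hB⟩ := hK.exists_bound hcK (l.coneLinear C) l.continuous.continuousOn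
  have hlim : ∀ r : ℕ → E, (∀ n, r n ∈ C) → Tendsto (fun n => baseCoeff K (r n)) atTop (𝓝 0) →
      Tendsto (fun n => l (r n)) atTop (𝓝 0) := fun r hr hrl => by
    refine squeeze_zero_norm (fun n => hB (r n) (hr n)) ?_
    simpa using hrl.const_mul B
  have h1 := (hlim p hp hpl).sub (hlim q hq hql)
  rw [sub_zero] at h1
  refine tendsto_nhds_unique (Tendsto.congr (fun n => ?_) tendsto_const_nhds) h1
  rw [← map_sub, ← map_sub, h n]

section Neumann

variable {P : E → E} {θ : ℝ}

omit [TopologicalSpace E] [IsTopologicalAddGroup E] [ContinuousSMul ℝ E] [LocallyConvexSpace ℝ E]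
  [T2Space E] in
theorem iterate_mem (hPC : ∀ x ∈ C, P x ∈ C) {x : E} (hx : x ∈ C) (n : ℕ) : P^[n] x ∈ C := by
  induction n with
  | zero => exact hx
  | succ n ih => rw [Function.iterate_succ_apply']; exact hPC _ ih

omit [TopologicalSpace E] [IsTopologicalAddGroup E] [ContinuousSMul ℝ E] [LocallyConvexSpace ℝ E]
  [T2Space E] in
theorem baseCoeff_iterate_le (hPC : ∀ x ∈ C, P x ∈ C)
    (h0 : 0 ≤ θ) (hθ : ∀ x ∈ C, baseCoeff K (P x) ≤ θ * baseCoeff K x) {x : E} (hx : x ∈ C)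
    (n : ℕ) : baseCoeff K (P^[n] x) ≤ θ ^ n * baseCoeff K x := by
  induction n with
  | zero => simp
  | succ n ih =>
    rw [Function.iterate_succ_apply', pow_succ', mul_assoc]
    exact (hθ _ (iterate_mem hPC hx n)).trans (mul_le_mul_of_nonneg_left ih h0)

omit [TopologicalSpace E] [IsTopologicalAddGroup E] [ContinuousSMul ℝ E] [LocallyConvexSpace ℝ E]
  [T2Space E] in
theorem tendsto_baseCoeff_iterate (hK : IsBase C K) (hPC : ∀ x ∈ C, P x ∈ C)
    (h0 : 0 ≤ θ) (h1 : θ < 1) (hθ : ∀ x ∈ C, baseCoeff K (P x) ≤ θ * baseCoeff K x) {x : E}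
    (hx : x ∈ C) : Tendsto (fun n => baseCoeff K (P^[n] x)) atTop (𝓝 0) := by
  refine squeeze_zero (fun n => hK.baseCoeff_nonneg (iterate_mem hPC hx n))
    (fun n => baseCoeff_iterate_le hPC h0 hθ hx n) ?_
  simpa using (tendsto_pow_atTop_nhds_zero_of_lt_one h0 h1).mul_const (baseCoeff K x)

/-- The equation says `x - y = P x - P y`, written with sums because `P` is additive only on `C`.
Iterating, `x - y` is a difference of the arbitrarily small elements `P^[n] x` and `P^[n] y`. -/
theorem eq_of_add_contraction_eq (hK : IsBase C K) (hcK : IsCompact K) (hP : ConeLinear C P)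
    (hPC : ∀ x ∈ C, P x ∈ C) (h0 : 0 ≤ θ) (h1 : θ < 1)
    (hθ : ∀ x ∈ C, baseCoeff K (P x) ≤ θ * baseCoeff K x) {x y : E} (hx : x ∈ C) (hy : y ∈ C)
    (h : x + P y = y + P x) : x = y := by
  have key : ∀ n, P^[n] x + P^[n + 1] y = P^[n] y + P^[n + 1] x := by
    intro n
    induction n with
    | zero => exact h
    | succ n ih =>
      have e := congrArg P ih
      rw [hP.map_add _ (iterate_mem hPC hx _) _ (iterate_mem hPC hy _),
        hP.map_add _ (iterate_mem hPC hy _) _ (iterate_mem hPC hx _)] at e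
      simpa only [← Function.iterate_succ_apply' (f := P)] using e
  have key' : ∀ n, x - y = P^[n] x - P^[n] y := by
    intro n
    induction n with
    | zero => rfl
    | succ n ih =>
      rw [ih, sub_eq_sub_iff_add_eq_add, key n, add_comm]
  exact eq_of_sub_eq_small hK hcK (fun n => iterate_mem hPC hx n) (fun n => iterate_mem hPC hy n)
    key' (tendsto_baseCoeff_iterate hK hPC h0 h1 hθ hx)
    (tendsto_baseCoeff_iterate hK hPC h0 h1 hθ hy)

theorem exists_eq_contraction_add (hK : IsBase C K) (hcK : IsCompact K) (hP : ConeLinear C P)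
    (hPC : ∀ x ∈ C, P x ∈ C) (h0 : 0 ≤ θ) (h1 : θ < 1)
    (hθ : ∀ x ∈ C, baseCoeff K (P x) ≤ θ * baseCoeff K x) {y : E} (hy : y ∈ C) :
    ∃ z ∈ C, z = P z + y := by
  -- Partial sums of the Neumann series `∑ P^[n] y`.
  let s : ℕ → E := fun n => Nat.rec 0 (fun _ c => P c + y) n
  have hs_succ : ∀ n, s (n + 1) = P (s n) + y := fun n => rfl
  have hsC : ∀ n, s n ∈ C := by
    intro n
    induction n with
    | zero => exact C.zero_mem
    | succ n ih => exact C.add_mem (hPC _ ih) hy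
  -- The sum of the dominating geometric series, that is, the fixed point of `t ↦ θ * t + baseCoeff
  -- K y`.
  set A : ℝ := baseCoeff K y / (1 - θ)
  have hA : θ * A + baseCoeff K y = A := by
    have : 1 - θ ≠ 0 := by linarith
    simp only [A]; field_simp; ring
  have hA0 : 0 ≤ A := div_nonneg (hK.baseCoeff_nonneg hy) (by linarith)
  have hsA : ∀ n, baseCoeff K (s n) ≤ A := by
    intro n
    induction n with
    | zero => rw [show s 0 = 0 from rfl, hK.baseCoeff_zero]; exact hA0
    | succ n ih =>
      rw [hs_succ, hK.coneLinear.map_add _ (hPC _ (hsC n)) _ hy]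
      linarith [hθ _ (hsC n), mul_le_mul_of_nonneg_left ih h0]
  have hs_add : ∀ n k, s (n + k) = s n + P^[n] (s k) := by
    intro n k
    induction n with
    | zero => simp [show s 0 = 0 from rfl]
    | succ n ih =>
      rw [show n + 1 + k = (n + k) + 1 by ring, hs_succ, ih, hs_succ,
        hP.map_add _ (hsC n) _ (iterate_mem hPC (hsC k) n), Function.iterate_succ_apply']
      abel
  obtain ⟨z, hz, hlim⟩ := (hK.isCompact_sublevel hcK A).ultrafilter_le_nhds
    ((Ultrafilter.of (atTop : Filter ℕ)).map s) (by
      rw [le_principal_iff, Ultrafilter.mem_coe, Ultrafilter.mem_map]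
      exact Filter.univ_mem' fun n => ⟨hsC n, hsA n⟩)
  have hlim : Tendsto s (Ultrafilter.of (atTop : Filter ℕ) : Filter ℕ) (𝓝 z) := hlim
  -- The tail `z - s n` is a limit of points `P^[n] (s k)`, which stay in a compact sublevel set of
  -- `C`.
  have hr : ∀ n, z - s n ∈ C ∧ baseCoeff K (z - s n) ≤ θ ^ n * A := by
    intro n
    refine (hK.isCompact_sublevel hcK (θ ^ n * A)).isClosed.mem_of_tendsto
      (hlim.sub tendsto_const_nhds) ((eventually_ge_atTop n).filter_mono
        (Ultrafilter.of_le atTop) |>.mono fun m hm => ?_)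
    obtain ⟨k, rfl⟩ := Nat.exists_eq_add_of_le hm
    rw [hs_add, add_sub_cancel_left]
    exact ⟨iterate_mem hPC (hsC k) n, (baseCoeff_iterate_le hPC h0 hθ (hsC k) n).trans
      (mul_le_mul_of_nonneg_left (hsA k) (pow_nonneg h0 n))⟩
  have hrl : Tendsto (fun n => baseCoeff K (z - s n)) atTop (𝓝 0) := by
    refine squeeze_zero (fun n => hK.baseCoeff_nonneg (hr n).1) (fun n => (hr n).2) ?_
    simpa using (tendsto_pow_atTop_nhds_zero_of_lt_one h0 h1).mul_const A
  refine ⟨z, hz.1, eq_of_sub_eq_small hK hcK (p := fun n => z - s (n + 1))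
    (q := fun n => P (z - s n)) (fun n => (hr (n + 1)).1) (fun n => hPC _ (hr n).1) (fun n => ?_)
    (hrl.comp (tendsto_add_atTop_nat 1)) ?_⟩
  · have : P z = P (s n) + P (z - s n) := by
      rw [← hP.map_add _ (hsC n) _ (hr n).1, add_sub_cancel]
    rw [hs_succ, this]
    abel
  · refine squeeze_zero (fun n => hK.baseCoeff_nonneg (hPC _ (hr n).1)) (fun n => hθ _ (hr n).1) ?_
    simpa using hrl.const_mul θ

end Neumann

/-- With `P = 1 - M⁻¹ T` one has `T = M (1 - P)`, and `P` maps `C` into itself and contracts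
coefficients by `1 - m / M`; so `1 - P` is inverted by the Neumann series. -/
theorem bijOn_of_bounds (hK : IsBase C K) (hcK : IsCompact K) {T : E → E} (hT : ConeLinear C T)
    (hTC : ∀ x ∈ C, T x ∈ C) {m M : ℝ} (hm : 0 < m) (hM : 0 < M)
    (hTM : ∀ x ∈ C, M • x - T x ∈ C) (hTm : ∀ x ∈ C, m * baseCoeff K x ≤ baseCoeff K (T x)) :
    Set.BijOn T C C := by
  let P : E → E := fun x => M⁻¹ • (M • x - T x)
  have hPC : ∀ x ∈ C, P x ∈ C := fun x hx =>
    PointedCone.smul_mem C (inv_nonneg.2 hM.le) (hTM x hx)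
  have hPx : ∀ x, P x = x - M⁻¹ • T x := fun x => by
    simp only [P]; rw [smul_sub, smul_smul, inv_mul_cancel₀ hM.ne', one_smul]
  have hP : ConeLinear C P := by
    refine ⟨fun x hx y hy => ?_, fun t ht x hx => ?_⟩
    · simp only [hPx, hT.map_add x hx y hy, smul_add]; abel
    · simp only [hPx, hT.map_smul t ht x hx, smul_sub]; rw [smul_comm]
  -- The maximum with `0` keeps the factor nonnegative: `m ≤ M` is not assumed, and it can fail when
  -- `C` is trivial.
  have hfP : ∀ x ∈ C, baseCoeff K (P x) ≤ max (1 - M⁻¹ * m) 0 * baseCoeff K x := fun x hx => by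
    have e : baseCoeff K x = baseCoeff K (P x) + M⁻¹ * baseCoeff K (T x) := by
      rw [← smul_eq_mul, ← hK.coneLinear.map_smul _ (inv_nonneg.2 hM.le) _ (hTC x hx),
        ← hK.coneLinear.map_add _ (hPC x hx) _
          (PointedCone.smul_mem C (inv_nonneg.2 hM.le) (hTC x hx)), hPx, sub_add_cancel]
    have e1 := mul_le_mul_of_nonneg_left (hTm x hx) (inv_nonneg.2 hM.le)
    have e2 := mul_le_mul_of_nonneg_right (le_max_left (1 - M⁻¹ * m) 0) (hK.baseCoeff_nonneg hx)
    linarith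
  have hθ : max (1 - M⁻¹ * m) 0 < 1 := max_lt (by have := mul_pos (inv_pos.2 hM) hm; linarith)
    one_pos
  refine ⟨hTC, fun x hx y hy hxy => ?_, fun y hy => ?_⟩
  · refine eq_of_add_contraction_eq hK hcK hP hPC (le_max_right _ _) hθ hfP hx hy ?_
    rw [hPx, hPx, hxy]; abel
  · obtain ⟨z, hz, h⟩ := exists_eq_contraction_add hK hcK hP hPC (le_max_right _ _) hθ hfP
      (PointedCone.smul_mem C (inv_nonneg.2 hM.le) hy)
    refine ⟨z, hz, ?_⟩
    rw [hPx] at h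
    have h2 : M⁻¹ • T z = M⁻¹ • y := by
      rwa [sub_add, eq_comm, sub_eq_self, sub_eq_zero] at h
    exact smul_right_injective E (inv_ne_zero hM.ne') h2

/-- A bijective linear self-map of a lattice cone that multiplies each extreme point of the base
`K` by the value of `g` there. -/
theorem exists_multiplier (hC : IsLatticeCone C) (hK : IsBase C K) (hcK : IsCompact K) {g : E → ℝ}
    (hg : ConeLinear C g) (hgc : ContinuousOn g K) (hg0 : ∀ k ∈ K, 0 < g k) :
    ∃ T : E → E, ConeLinear C T ∧ Set.BijOn T C C ∧ (∀ x ∈ C, baseCoeff K (T x) = g x) ∧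
      (∀ x ∈ C, ∀ l : E →L[ℝ] ℝ, l (T x) =
        (envelope C K (fun c => l c + g c) x - envelope C K (fun c => l c - g c) x) / 4) ∧
      ∀ x ∈ K.extremePoints ℝ, T x = g x • x := by
  obtain ⟨m, hm, hgm⟩ : ∃ m : ℝ, 0 < m ∧ ∀ k ∈ K, m ≤ g k := by
    rcases K.eq_empty_or_nonempty with rfl | hne
    · exact ⟨1, one_pos, by simp⟩
    · obtain ⟨k, hk, hmin⟩ := hcK.exists_isMinOn hne hgc
      exact ⟨g k, hg0 k hk, fun x hx => hmin hx⟩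
  have hgf : ∀ c ∈ C, m * baseCoeff K c ≤ g c := fun c hc => by
    rcases eq_or_ne c 0 with rfl | h0
    · simp [hg.map_zero, hK.baseCoeff_zero]
    · obtain ⟨hp, k, hk, hck⟩ := hK.exists_eq_smul hc h0
      have : g c = baseCoeff K c * g k := by
        conv_lhs => rw [hck]
        rw [hg.map_smul _ hp.le _ (hK.subset hk), smul_eq_mul]
      rw [this, mul_comm]
      exact mul_le_mul_of_nonneg_left (hgm k hk) hp.le
  have hgC : ∀ c ∈ C, 0 ≤ g c := fun c hc =>
    (mul_nonneg hm.le (hK.baseCoeff_nonneg hc)).trans (hgf c hc)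
  obtain ⟨M, hM0, hM⟩ := hK.exists_bound hcK hg hgc
  -- The bound `M` may be `0`; `M + 1` is positive, as the inversion requires.
  have hgM : ∀ c ∈ C, g c ≤ (M + 1) * baseCoeff K c := fun c hc => by
    linarith [(le_abs_self _).trans (hM c hc), hK.baseCoeff_nonneg hc]
  choose! T hTC hfT hTM hlT using fun (x : E) (hx : x ∈ C) =>
    exists_multiplier_at hC hK hcK hg hgc hgC hgM hx
  have henv : ∀ l : E →L[ℝ] ℝ, ConeLinear C (fun x =>
      (envelope C K (fun c => l c + g c) x - envelope C K (fun c => l c - g c) x)) := fun l => by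
    obtain ⟨B₁, -, hB₁⟩ := hK.exists_bound hcK ((l.coneLinear C).add hg)
      (l.continuous.continuousOn.add hgc)
    obtain ⟨B₂, -, hB₂⟩ := hK.exists_bound hcK ((l.coneLinear C).sub hg)
      (l.continuous.continuousOn.sub hgc)
    exact (envelope_coneLinear hC hK ((l.coneLinear C).add hg) hB₁).sub
      (envelope_coneLinear hC hK ((l.coneLinear C).sub hg) hB₂)
  have hT : ConeLinear C T := by
    refine ⟨fun x hx y hy => eq_of_forall_continuousLinearMap fun l => ?_,
      fun t ht x hx => eq_of_forall_continuousLinearMap fun l => ?_⟩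
    · rw [map_add, hlT _ (C.add_mem hx hy), hlT x hx, hlT y hy]
      rw [(henv l).map_add x hx y hy]; ring
    · rw [map_smul, hlT _ (PointedCone.smul_mem C ht hx), hlT x hx]
      rw [(henv l).map_smul t ht x hx, smul_eq_mul, smul_eq_mul]; ring
  refine ⟨T, hT, bijOn_of_bounds hK hcK hT hTC hm (by linarith : 0 < M + 1) hTM
    (fun x hx => by rw [hfT x hx]; exact hgf x hx), hfT, hlT, fun x hx => ?_⟩
  refine eq_of_forall_continuousLinearMap fun l => ?_
  rw [hlT x (hK.subset hx.1), envelope_extreme hK ((l.coneLinear C).add hg) hx,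
    envelope_extreme hK ((l.coneLinear C).sub hg) hx, map_smul, smul_eq_mul]
  ring

end SimplexCone

/-! ### Continuity of envelopes when the extreme boundary is closed -/

namespace SimplexCone

open Filter Topology

section ConvexHull

open scoped Pointwise

variable {W : Type*} [AddCommGroup W] [Module ℝ W] [TopologicalSpace W] [IsTopologicalAddGroup W]
  [ContinuousSMul ℝ W]

theorem isCompact_convexJoin {s t : Set W} (hs : IsCompact s) (ht : IsCompact t) :
    IsCompact (convexJoin ℝ s t) := by
  have : convexJoin ℝ s t = (fun p : ℝ × W × W => (1 - p.1) • p.2.1 + p.1 • p.2.2) ''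
      (Set.Icc 0 1 ×ˢ s ×ˢ t) := by
    ext x
    simp only [mem_convexJoin, segment_eq_image, Set.mem_image, Set.mem_prod, Prod.exists]
    constructor
    · rintro ⟨a, ha, b, hb, r, hr, rfl⟩
      exact ⟨r, a, b, ⟨hr, ha, hb⟩, rfl⟩
    · rintro ⟨r, a, b, ⟨hr, ha, hb⟩, rfl⟩
      exact ⟨a, ha, b, hb, r, hr, rfl⟩
  rw [this]
  exact (isCompact_Icc.prod (hs.prod ht)).image (by fun_prop)

/-- A convex function on the compact closed convex hull of a compact set `Z` whose upper limit at
each point of `Z` is at most `0` is nowhere positive. -/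
theorem nonpos_of_eventually_le [LocallyConvexSpace ℝ W] [T2Space W] {Z : Set W}
    (hZ : IsCompact Z) (hQ : IsCompact (closedConvexHull ℝ Z)) {φ : W → ℝ}
    (hφ : ConvexOn ℝ (closedConvexHull ℝ Z) φ)
    (hlim : ∀ z ∈ Z, ∀ ε > 0, ∀ᶠ w in 𝓝[closedConvexHull ℝ Z] z, φ w ≤ ε) :
    ∀ w ∈ closedConvexHull ℝ Z, φ w ≤ 0 := by
  intro w hw
  refine le_of_forall_pos_le_add fun ε hε => ?_
  rw [zero_add]
  set U : Set W := {w ∈ closedConvexHull ℝ Z | φ w ≤ ε}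
  have hU : Convex ℝ U := hφ.convex_le ε
  -- Locally `Z` is covered by compact convex subsets of `U`. Finitely many suffice, and their
  -- convex joins stay compact, convex and inside `U`. Such a closed convex set contains the closed
  -- convex hull of `Z`, although `U` itself need not be closed.
  have key : ∃ B : Set W, IsCompact B ∧ Convex ℝ B ∧ Z ⊆ B ∧ B ⊆ U := by
    refine hZ.induction_on (p := fun S => ∃ B : Set W, IsCompact B ∧ Convex ℝ B ∧ S ⊆ B ∧ B ⊆ U)
      ⟨∅, isCompact_empty, convex_empty, subset_rfl, Set.empty_subset _⟩ ?_ ?_ ?_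
    · rintro s t hst ⟨B, h1, h2, h3, h4⟩
      exact ⟨B, h1, h2, hst.trans h3, h4⟩
    · rintro s t ⟨B, h1, h2, h3, h4⟩ ⟨B', h1', h2', h3', h4'⟩
      rcases B.eq_empty_or_nonempty with rfl | hB
      · exact ⟨B', h1', h2', Set.union_subset (h3.trans (Set.empty_subset _)) h3', h4'⟩
      rcases B'.eq_empty_or_nonempty with rfl | hB'
      · exact ⟨B, h1, h2, Set.union_subset h3 (h3'.trans (Set.empty_subset _)), h4⟩
      exact ⟨convexJoin ℝ B B', isCompact_convexJoin h1 h1', h2.convexJoin h2',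
        Set.union_subset (h3.trans (subset_convexJoin_left hB'))
          (h3'.trans (subset_convexJoin_right hB)), convexJoin_subset h4 h4' hU⟩
    · intro z hz
      obtain ⟨V, hV, hVU⟩ := mem_nhdsWithin_iff_exists_mem_nhds_inter.1 (hlim z hz ε hε)
      obtain ⟨V', ⟨hV', hV'c⟩, hV'V⟩ := (closed_nhds_basis z).mem_iff.1 hV
      obtain ⟨N, ⟨hN, hNc⟩, hNV'⟩ := (LocallyConvexSpace.convex_basis (𝕜 := ℝ) z).mem_iff.1 hV'
      have hNV : closure N ⊆ V := (closure_minimal hNV' hV'c).trans hV'V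
      refine ⟨N ∩ Z, inter_mem (mem_nhdsWithin_of_mem_nhds hN) self_mem_nhdsWithin,
        closedConvexHull ℝ Z ∩ closure N, hQ.inter_right isClosed_closure,
        convex_closedConvexHull.inter hNc.closure,
        fun x hx => ⟨subset_closedConvexHull hx.2, subset_closure hx.1⟩,
        fun x hx => ⟨hx.1, hVU ⟨hNV hx.2, hx.1⟩⟩⟩
  obtain ⟨B, h1, h2, h3, h4⟩ := key
  exact (h4 (closedConvexHull_min h3 h2 h1.isClosed hw)).2

end ConvexHull

variable {E : Type*} [AddCommGroup E] [Module ℝ E] [TopologicalSpace E] [IsTopologicalAddGroup E]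
  [ContinuousSMul ℝ E] [LocallyConvexSpace ℝ E] [T2Space E] {C : PointedCone ℝ E} {K : Set E}
  {h : E → ℝ}

omit [IsTopologicalAddGroup E] [ContinuousSMul ℝ E] [LocallyConvexSpace ℝ E] in
theorem closedConvexHull_graph_subset (hcK : IsCompact K) (hconv : Convex ℝ K)
    (hhc : ContinuousOn h K) {X : Set E} (hX : X ⊆ K) :
    closedConvexHull ℝ ((fun k => (k, h k ^ 2)) '' X) ⊆ K ×ˢ (Set.univ : Set ℝ) ∧
    IsCompact (closedConvexHull ℝ ((fun k => (k, h k ^ 2)) '' X)) := by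
  obtain ⟨B, hB⟩ := hcK.exists_bound_of_continuousOn hhc
  have hsub : closedConvexHull ℝ ((fun k => (k, h k ^ 2)) '' X) ⊆ K ×ˢ Set.Icc 0 (B ^ 2) := by
    refine closedConvexHull_min ?_ (hconv.prod (convex_Icc _ _)) (hcK.isClosed.prod isClosed_Icc)
    rintro _ ⟨k, hk, rfl⟩
    have := hB k (hX hk)
    exact ⟨hX hk, sq_nonneg _, sq_le_sq' (abs_le.1 this).1 (abs_le.1 this).2⟩
  exact ⟨hsub.trans (Set.prod_mono subset_rfl (Set.subset_univ _)),
    (hcK.prod isCompact_Icc).of_isClosed_subset isClosed_closedConvexHull hsub⟩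

section Envelope

variable {B : ℝ} (hC : IsLatticeCone C) (hK : IsBase C K) (hcK : IsCompact K)
  (hh : ConeLinear C h) (hhc : ContinuousOn h K)
  (hB : ∀ c ∈ C, |h c| ≤ B * baseCoeff K c)

include hC hK hh hB in
omit [TopologicalSpace E] [IsTopologicalAddGroup E] [ContinuousSMul ℝ E] [LocallyConvexSpace ℝ E]
  [T2Space E] in
theorem envelope_combo {x y : E} (hx : x ∈ K) (hy : y ∈ K) {a b : ℝ} (ha : 0 ≤ a) (hb : 0 ≤ b) :
    envelope C K h (a • x + b • y) = a * envelope C K h x + b * envelope C K h y := by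
  have he := envelope_coneLinear hC hK hh hB
  rw [he.map_add _ (PointedCone.smul_mem C ha (hK.subset hx)) _
    (PointedCone.smul_mem C hb (hK.subset hy)), he.map_smul a ha _ (hK.subset hx),
    he.map_smul b hb _ (hK.subset hy), smul_eq_mul, smul_eq_mul]

include hC hK hcK hh hhc hB

/-- The function `p.2 - envelope C K h p.1` is affine on the hull, and is at most `p.2 - h p.1 ^ 2`,
which is continuous there and vanishes on the graph of `h²`. So `nonpos_of_eventually_le` applies.
-/
theorem snd_le_envelope {p : E × ℝ}
    (hp : p ∈ closedConvexHull ℝ ((fun k => (k, h k ^ 2)) '' K)) : p.2 ≤ envelope C K h p.1 := by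
  obtain ⟨hsub, hcomp⟩ := closedConvexHull_graph_subset hcK hK.convex hhc (subset_refl K)
  have hZ : IsCompact ((fun k => (k, h k ^ 2)) '' K) :=
    hcK.image_of_continuousOn (continuousOn_id.prodMk (hhc.pow 2))
  have := nonpos_of_eventually_le (φ := fun p => p.2 - envelope C K h p.1) hZ hcomp
    ⟨convex_closedConvexHull, ?_⟩ ?_ p hp
  · linarith
  · intro p hp q hq a b ha hb _
    simp only [Prod.snd_add, Prod.smul_snd, Prod.fst_add, Prod.smul_fst, smul_eq_mul]
    rw [envelope_combo hC hK hh hB (hsub hp).1 (hsub hq).1 ha hb]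
    exact le_of_eq (by ring)
  · rintro _ ⟨k, hk, rfl⟩ ε hε
    have hcont : ContinuousOn (fun p : E × ℝ => p.2 - h p.1 ^ 2) (K ×ˢ Set.univ) :=
      continuous_snd.continuousOn.sub ((hhc.comp continuous_fst.continuousOn fun p hp => hp.1).pow 2)
    have h1 := (hcont (k, h k ^ 2) ⟨hk, trivial⟩).mono hsub
    filter_upwards [Tendsto.eventually_lt_const (u := ε) (by simpa using hε) h1, self_mem_nhdsWithin]
      with w hw hwQ
    have h2 := energy_le_envelope hK hB (hK.subset (hsub hwQ).1)
    rw [energy, hK.baseCoeff_eq_one (hsub hwQ).1, div_one] at h2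
    linarith

open scoped Pointwise in
omit [IsTopologicalAddGroup E] [ContinuousSMul ℝ E] [LocallyConvexSpace ℝ E] [T2Space E]
  hC hcK hhc in
-- A decomposition of `x` exhibits the pair of `x` and its energy as a convex combination of points
-- of the graph of `h²`; the supremum of the energies is a limit of such values.
theorem mk_envelope_mem {x : E} (hx : x ∈ K) :
    (x, envelope C K h x) ∈ closedConvexHull ℝ ((fun k => (k, h k ^ 2)) '' K) := by
  set H := closedConvexHull ℝ ((fun k => (k, h k ^ 2)) '' K)
  have hne : H.Nonempty := ⟨_, subset_closedConvexHull ⟨x, hx, rfl⟩⟩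
  have hone : ∀ c ∈ C, (c, energy K h c) ∈ baseCoeff K c • H := by
    intro c hc
    rcases eq_or_ne c 0 with rfl | h0
    · rw [hK.baseCoeff_zero, Set.zero_smul_set hne, (energy_isSubadditive hK hh).1]
      rfl
    · obtain ⟨hp, k, hk, hck⟩ := hK.exists_eq_smul hc h0
      refine ⟨(k, h k ^ 2), subset_closedConvexHull ⟨k, hk, rfl⟩, ?_⟩
      have h1 : energy K h c = baseCoeff K c * h k ^ 2 := by
        conv_lhs => rw [hck]
        rw [energy_smul hK hh hp (hK.subset hk), energy, hK.baseCoeff_eq_one hk, div_one]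
      rw [h1]
      exact Prod.ext hck.symm rfl
  -- Induction on pieces avoids normalizing partial sums: for convex `H` and nonnegative `a`, `b`,
  -- one has `(a + b) • H = a • H + b • H`.
  have hsum : ∀ s : Multiset E, (∀ c ∈ s, c ∈ C) →
      (s.sum, (s.map (energy K h)).sum) ∈ baseCoeff K s.sum • H := by
    intro s
    induction s using Multiset.induction_on with
    | empty =>
      intro _
      rw [Multiset.sum_zero, hK.baseCoeff_zero, Set.zero_smul_set hne]
      rfl
    | cons c s ih =>
      intro hs
      have hc := hs c (Multiset.mem_cons_self c s)
      have hs' : ∀ c ∈ s, c ∈ C := fun d hd => hs d (Multiset.mem_cons_of_mem hd)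
      have hsC : s.sum ∈ C := C.toAddSubmonoid.multiset_sum_mem s hs'
      rw [Multiset.map_cons, Multiset.sum_cons, Multiset.sum_cons, hK.coneLinear.map_add _ hc _ hsC,
        convex_closedConvexHull.add_smul (hK.baseCoeff_nonneg hc) (hK.baseCoeff_nonneg hsC)]
      exact Set.add_mem_add (hone c hc) (ih hs')
  have hxC := hK.subset hx
  obtain ⟨u, -, hu⟩ := exists_seq_tendsto_sSup (S := Set.range fun D : Decomposition C x =>
    (D.1.map (energy K h)).sum) (by have := Decomposition.nonempty hxC; exact Set.range_nonempty _)
    (bddAbove_sum_energy hK hB x)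
  refine isClosed_closedConvexHull.mem_of_tendsto
    (tendsto_const_nhds.prodMk_nhds hu.1) (Eventually.of_forall fun n => ?_)
  obtain ⟨D, hD⟩ := hu.2 n
  have := hsum D.1 D.2.1
  rw [D.2.2, hK.baseCoeff_eq_one hx, one_smul] at this
  rwa [← hD]

/-- By the two preceding results the envelope is the upper boundary of a compact set over `K`, hence
upper semicontinuous. -/
theorem eventually_envelope_lt {y : E} (hy : y ∈ K) {ε : ℝ} (hε : 0 < ε) :
    ∀ᶠ x in 𝓝[K] y, envelope C K h x < envelope C K h y + ε := by
  obtain ⟨-, hcomp⟩ := closedConvexHull_graph_subset hcK hK.convex hhc (subset_refl K)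
  have hcl : IsClosed (Prod.fst '' (closedConvexHull ℝ ((fun k => (k, h k ^ 2)) '' K) ∩
      Prod.snd ⁻¹' Set.Ici (envelope C K h y + ε))) :=
    ((hcomp.inter_right (isClosed_Ici.preimage continuous_snd)).image continuous_fst).isClosed
  have hyn : y ∉ Prod.fst '' (closedConvexHull ℝ ((fun k => (k, h k ^ 2)) '' K) ∩
      Prod.snd ⁻¹' Set.Ici (envelope C K h y + ε)) := by
    rintro ⟨⟨y', s⟩, ⟨h1, h2⟩, rfl⟩
    have h3 := snd_le_envelope hC hK hcK hh hhc hB h1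
    simp only [Set.mem_preimage, Set.mem_Ici] at h2 h3
    linarith
  filter_upwards [mem_nhdsWithin_of_mem_nhds (hcl.isOpen_compl.mem_nhds hyn), self_mem_nhdsWithin]
    with x hx hxK
  by_contra hlt
  exact hx ⟨(x, envelope C K h x), ⟨mk_envelope_mem hK hh hB hxK, not_lt.1 hlt⟩, rfl⟩

/-- Envelopes are continuous on a base with closed extreme boundary. -/
theorem continuousOn_envelope (hX : IsClosed (K.extremePoints ℝ)) :
    ContinuousOn (envelope C K h) K := by
  have hXK : K.extremePoints ℝ ⊆ K := extremePoints_subset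
  have hcX : IsCompact (K.extremePoints ℝ) := hcK.of_isClosed_subset hX hXK
  set G := closedConvexHull ℝ ((fun k => (k, h k ^ 2)) '' K.extremePoints ℝ) with hG
  obtain ⟨hsub, hcomp⟩ := closedConvexHull_graph_subset hcK hK.convex hhc hXK
  have hZ : IsCompact ((fun k => (k, h k ^ 2)) '' K.extremePoints ℝ) :=
    hcX.image_of_continuousOn (continuousOn_id.prodMk ((hhc.mono hXK).pow 2))
  have hle : ∀ p ∈ G, p.2 ≤ envelope C K h p.1 := fun p hp =>
    snd_le_envelope hC hK hcK hh hhc hB ((closedConvexHull ℝ).monotone (Set.image_mono hXK) hp)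
  -- On `G`, which is spanned by extreme points only, the reverse inequality holds too: at these
  -- points the envelope equals `h²`, and upper semicontinuity bounds the upper limits. So `G` lies
  -- in the graph of the envelope.
  have hge : ∀ p ∈ G, envelope C K h p.1 ≤ p.2 := by
    intro p hp
    have := nonpos_of_eventually_le (φ := fun p => envelope C K h p.1 - p.2) hZ hcomp
      ⟨convex_closedConvexHull, ?_⟩ ?_ p hp
    · linarith
    · intro p hp q hq a b ha hb _
      simp only [Prod.snd_add, Prod.smul_snd, Prod.fst_add, Prod.smul_fst, smul_eq_mul]
      rw [envelope_combo hC hK hh hB (hsub hp).1 (hsub hq).1 ha hb]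
      exact le_of_eq (by ring)
    · rintro _ ⟨k, hk, rfl⟩ ε hε
      have h1 : Tendsto Prod.fst (𝓝[G] (k, h k ^ 2)) (𝓝[K] k) :=
        (continuous_fst.continuousWithinAt).tendsto_nhdsWithin fun p hp => (hsub hp).1
      have h2 : Tendsto Prod.snd (𝓝[G] (k, h k ^ 2)) (𝓝 (h k ^ 2)) :=
        continuous_snd.continuousWithinAt
      filter_upwards [h1.eventually (eventually_envelope_lt hC hK hcK hh hhc hB (hXK hk)
        (half_pos hε)), h2.eventually_const_lt (u := h k ^ 2 - ε / 2) (by linarith)] with w hw hw'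
      rw [envelope_extreme hK hh hk] at hw
      linarith
  have hproj : ∀ x ∈ K, (x, envelope C K h x) ∈ G := by
    intro x hx
    -- By Krein–Milman, `G` projects onto all of `K`. Hence `G` is the whole graph over `K`, and a
    -- compact graph gives continuity.
    have h1 : K ⊆ Prod.fst '' G := by
      conv_lhs => rw [← closure_convexHull_extremePoints hcK hK.convex]
      refine closure_minimal (convexHull_min ?_ ?_) (hcomp.image continuous_fst).isClosed
      · intro k hk
        exact ⟨_, subset_closedConvexHull ⟨k, hk, rfl⟩, rfl⟩
      · exact convex_closedConvexHull.linear_image (LinearMap.fst ℝ E ℝ)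
    obtain ⟨⟨x', r⟩, hp, rfl⟩ := h1 hx
    have : r = envelope C K h x' := le_antisymm (hle _ hp) (hge _ hp)
    rwa [this] at hp
  rw [continuousOn_iff_isClosed]
  intro t ht
  refine ⟨Prod.fst '' (G ∩ Prod.snd ⁻¹' t),
    ((hcomp.inter_right (ht.preimage continuous_snd)).image continuous_fst).isClosed, ?_⟩
  ext c
  constructor
  · rintro ⟨h1, h2⟩
    exact ⟨⟨_, ⟨hproj c h2, h1⟩, rfl⟩, h2⟩
  · rintro ⟨⟨⟨c', s⟩, ⟨h1, h2⟩, rfl⟩, h3⟩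
    have : s = envelope C K h c' := le_antisymm (hle _ h1) (hge _ h1)
    exact ⟨by rw [Set.mem_preimage, ← this]; exact h2, h3⟩

end Envelope

/-- A map into a compact set is continuous if it is so after composition with every continuous
linear functional. -/
theorem continuousOn_of_forall_continuousLinearMap {T : E → E} {L : Set E} (hL : IsCompact L)
    (hTL : Set.MapsTo T K L) (hT : ∀ l : E →L[ℝ] ℝ, ContinuousOn (fun x => l (T x)) K) :
    ContinuousOn T K := by
  intro x hx
  rw [ContinuousWithinAt, tendsto_iff_ultrafilter]
  intro U hU
  have hKU : K ∈ U := hU self_mem_nhdsWithin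
  obtain ⟨z, -, hz⟩ := hL.ultrafilter_le_nhds (U.map T) (by
    rw [le_principal_iff, Ultrafilter.mem_coe, Ultrafilter.mem_map]
    exact Filter.mem_of_superset hKU hTL)
  have hz : Tendsto T U (𝓝 z) := hz
  have : z = T x := eq_of_forall_continuousLinearMap fun l =>
    tendsto_nhds_unique ((l.continuous.tendsto z).comp hz) ((hT l x hx).mono_left hU)
  rwa [← this]

end SimplexCone

/-! ### From affine homeomorphisms of cones to projective maps of bases -/

namespace SimplexCone

theorem IsAffine.symm {E : Type u} {F : Type v} [AddCommGroup E] [Module ℝ E] [AddCommGroup F]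
    [Module ℝ F] {K : Set E} {L : Set F} {e : K ≃ L} (hK : Convex ℝ K) (he : IsAffine e) :
    IsAffine e.symm := by
  intro x y z a b ha hb hab hz
  have hw := hK (e.symm x).2 (e.symm y).2 ha hb hab
  have h1 := he (e.symm x) (e.symm y) ⟨_, hw⟩ a b ha hb hab rfl
  rw [e.apply_symm_apply, e.apply_symm_apply, ← hz] at h1
  rw [(Equiv.symm_apply_eq e).2 (Subtype.ext h1).symm]

open Classical in
/-- The extension by zero of a map between cones. -/
noncomputable def extendZero {E : Type u} {F : Type v} [AddCommGroup F] {C : Set E} {D : Set F}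
    (e : C → D) (x : E) : F :=
  if h : x ∈ C then e ⟨x, h⟩ else 0

theorem extendZero_apply {E : Type u} {F : Type v} [AddCommGroup F] {C : Set E} {D : Set F}
    (e : C → D) {x : E} (h : x ∈ C) : extendZero e x = e ⟨x, h⟩ := dif_pos h

section

variable {E : Type u} {F : Type v} [AddCommGroup E] [Module ℝ E] [AddCommGroup F] [Module ℝ F]
  {C : PointedCone ℝ E} {D : PointedCone ℝ F}

/-- For `t ≤ 1`, `t • x` is a convex combination of `x` and `0`; inversion handles `t ≥ 1`. A sum is
twice a midpoint. -/
theorem coneLinear_extendZero {e : ↥(C : Set E) → ↥(D : Set F)} (he : IsAffine e)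
    (h0 : (e ⟨0, C.zero_mem⟩ : F) = 0) : ConeLinear C (extendZero e) := by
  have hsmall : ∀ t : ℝ, 0 ≤ t → t ≤ 1 → ∀ x ∈ C, extendZero e (t • x) = t • extendZero e x := by
    intro t ht ht1 x hx
    have hx' := PointedCone.smul_mem C ht hx
    rw [extendZero_apply e hx, extendZero_apply e hx', he ⟨x, hx⟩ ⟨0, C.zero_mem⟩ ⟨t • x, hx'⟩ t
      (1 - t) ht (by linarith) (by ring) (by simp), h0, smul_zero, add_zero]
  have hsmul : ∀ t : ℝ, 0 ≤ t → ∀ x ∈ C, extendZero e (t • x) = t • extendZero e x := by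
    intro t ht x hx
    rcases le_total t 1 with h | h
    · exact hsmall t ht h x hx
    · have htp : 0 < t := by linarith
      have := hsmall t⁻¹ (inv_nonneg.2 ht) (inv_le_one_of_one_le₀ h) _
        (PointedCone.smul_mem C ht hx)
      rw [smul_smul, inv_mul_cancel₀ htp.ne', one_smul] at this
      rw [this, smul_smul, mul_inv_cancel₀ htp.ne', one_smul]
  refine ⟨fun x hx y hy => ?_, hsmul⟩
  have hz : (1 / 2 : ℝ) • x + (1 / 2 : ℝ) • y ∈ C :=
    C.add_mem (PointedCone.smul_mem C (by norm_num) hx) (PointedCone.smul_mem C (by norm_num) hy)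
  have h1 := he ⟨x, hx⟩ ⟨y, hy⟩ ⟨_, hz⟩ (1 / 2) (1 / 2) (by norm_num) (by norm_num) (by norm_num)
    rfl
  have h2 := hsmul 2 (by norm_num) _ hz
  rw [extendZero_apply e hz, h1, ← smul_add, ← smul_add, smul_smul, smul_smul] at h2
  rw [extendZero_apply e hx, extendZero_apply e hy]
  simpa using h2

/-- The image `a` of the apex is the midpoint of `0` and `2 • a` in `D`. Pulled back, the apex of
`C` is a midpoint of two points of `C`, which must both vanish since `C ∩ -C = {0}`; so `0` in `D`
comes from the apex. -/
theorem map_zero_of_isAffine (hC : ∀ x ∈ C, -x ∈ C → x = 0) {e : (C : Set E) ≃ (D : Set F)}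
    (he : IsAffine e) : (e ⟨0, C.zero_mem⟩ : F) = 0 := by
  set a := e ⟨0, C.zero_mem⟩ with ha
  have h2 : (2 : ℝ) • (a : F) ∈ D := PointedCone.smul_mem D (by norm_num) a.2
  have h1 := he.symm C.convex ⟨0, D.zero_mem⟩ ⟨_, h2⟩ a (1 / 2) (1 / 2) (by norm_num) (by norm_num)
    (by norm_num) (by simp [smul_smul])
  have hsa : e.symm a = ⟨0, C.zero_mem⟩ := e.symm_apply_apply _
  rw [hsa, ← smul_add] at h1
  have h3 := (smul_eq_zero.1 h1.symm).resolve_left (by norm_num)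
  have h4 : (e.symm ⟨0, D.zero_mem⟩ : E) = 0 := by
    refine hC _ (e.symm _).2 ?_
    rw [neg_eq_of_add_eq_zero_right h3]
    exact (e.symm _).2
  have h5 : e.symm ⟨0, D.zero_mem⟩ = ⟨0, C.zero_mem⟩ := Subtype.ext h4
  rw [ha, ← h5, e.apply_symm_apply]

end

/-- Mutually inverse, positively homogeneous, additive and relatively continuous maps between
two cones. -/
structure IsConeHomeo {E F : Type*} [AddCommGroup E] [Module ℝ E] [TopologicalSpace E]
    [AddCommGroup F] [Module ℝ F] [TopologicalSpace F] (C : PointedCone ℝ E)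
    (D : PointedCone ℝ F) (φ : E → F) (χ : F → E) : Prop where
  coneLinear : ConeLinear C φ
  coneLinear_inv : ConeLinear D χ
  map_mem : ∀ x ∈ C, φ x ∈ D
  map_mem_inv : ∀ y ∈ D, χ y ∈ C
  left_inv : ∀ x ∈ C, χ (φ x) = x
  right_inv : ∀ y ∈ D, φ (χ y) = y
  continuousOn : ContinuousOn φ C
  continuousOn_inv : ContinuousOn χ D

theorem AffinelyHomeomorphic.exists_isConeHomeo {E : Type u} {F : Type v} [AddCommGroup E]
    [Module ℝ E] [TopologicalSpace E] [AddCommGroup F] [Module ℝ F] [TopologicalSpace F]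
    {C : PointedCone ℝ E} {D : PointedCone ℝ F} (h : AffinelyHomeomorphic (C : Set E) (D : Set F))
    (hC : ∀ x ∈ C, -x ∈ C → x = 0) : ∃ (φ : E → F) (χ : F → E), IsConeHomeo C D φ χ := by
  obtain ⟨e, he⟩ := h
  have he' : IsAffine e.toEquiv := he
  have h0 : (e ⟨0, C.zero_mem⟩ : F) = 0 := map_zero_of_isAffine (e := e.toEquiv) hC he'
  have h0' : (e.symm ⟨0, D.zero_mem⟩ : E) = 0 := by
    have : (⟨0, D.zero_mem⟩ : (D : Set F)) = e ⟨0, C.zero_mem⟩ := Subtype.ext h0.symm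
    rw [this, e.symm_apply_apply]
  refine ⟨extendZero e, extendZero e.symm, coneLinear_extendZero he h0,
    coneLinear_extendZero (he'.symm C.convex) h0', fun x hx => ?_, fun y hy => ?_, fun x hx => ?_,
    fun y hy => ?_, ?_, ?_⟩
  · rw [extendZero_apply _ hx]; exact (e _).2
  · rw [extendZero_apply _ hy]; exact (e.symm _).2
  · rw [extendZero_apply e hx, extendZero_apply _ (e _).2]; simp
  · rw [extendZero_apply e.symm hy, extendZero_apply _ (e.symm _).2]; simp
  · rw [continuousOn_iff_continuous_domRestrict]
    refine (continuous_subtype_val.comp e.continuous).congr fun x => ?_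
    rw [Set.domRestrict_apply, extendZero_apply _ x.2]; rfl
  · rw [continuousOn_iff_continuous_domRestrict]
    refine (continuous_subtype_val.comp e.symm.continuous).congr fun x => ?_
    rw [Set.domRestrict_apply, extendZero_apply _ x.2]; rfl

namespace IsConeHomeo

variable {E F : Type*} [AddCommGroup E] [Module ℝ E] [TopologicalSpace E]
  [AddCommGroup F] [Module ℝ F] [TopologicalSpace F] {C : PointedCone ℝ E}
  {D : PointedCone ℝ F} {φ : E → F} {χ : F → E} {K : Set E} {L : Set F}

theorem symm (H : IsConeHomeo C D φ χ) : IsConeHomeo D C χ φ :=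
  ⟨H.2, H.1, H.4, H.3, H.6, H.5, H.8, H.7⟩

theorem map_ne_zero (H : IsConeHomeo C D φ χ) {x : E} (hx : x ∈ C) (h0 : x ≠ 0) : φ x ≠ 0 := by
  intro h
  apply h0
  rw [← H.left_inv x hx, h, H.coneLinear_inv.map_zero]

/-- The projective map between two bases induced by a linear homeomorphism of cones. -/
noncomputable def proj (L : Set F) (φ : E → F) (x : E) : F := (baseCoeff L (φ x))⁻¹ • φ x

theorem baseCoeff_pos (H : IsConeHomeo C D φ χ) (hK : IsBase C K) (hL : IsBase D L) {x : E}
    (hx : x ∈ K) : 0 < baseCoeff L (φ x) :=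
  hL.baseCoeff_pos (H.map_mem x (hK.subset hx)) (H.map_ne_zero (hK.subset hx) (hK.ne_zero hx))

theorem proj_mem (H : IsConeHomeo C D φ χ) (hK : IsBase C K) (hL : IsBase D L) {x : E}
    (hx : x ∈ K) : proj L φ x ∈ L :=
  hL.inv_smul_mem (H.map_mem x (hK.subset hx)) (H.map_ne_zero (hK.subset hx) (hK.ne_zero hx))

theorem proj_proj (H : IsConeHomeo C D φ χ) (hK : IsBase C K) (hL : IsBase D L) {x : E}
    (hx : x ∈ K) : proj K χ (proj L φ x) = x := by
  have hr := inv_pos.2 (H.baseCoeff_pos hK hL hx)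
  have : χ (proj L φ x) = (baseCoeff L (φ x))⁻¹ • x := by
    rw [proj, H.coneLinear_inv.map_smul _ hr.le _ (H.map_mem x (hK.subset hx)),
      H.left_inv x (hK.subset hx)]
  rw [proj, this, hK.baseCoeff_smul hr hx, smul_smul, inv_mul_cancel₀ hr.ne', one_smul]

/-- Extremality in a base means that all summands in the cone are proportional, a property of the
ray that linear isomorphisms of cones preserve. -/
theorem proj_mem_extremePoints (H : IsConeHomeo C D φ χ) (hK : IsBase C K) (hL : IsBase D L)
    {x : E} (hx : x ∈ K.extremePoints ℝ) : proj L φ x ∈ L.extremePoints ℝ := by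
  have hp := H.baseCoeff_pos hK hL hx.1
  have hxC := hK.subset hx.1
  refine hL.mem_extremePoints_of (H.proj_mem hK hL hx.1) fun a ha b hb hab => ?_
  set r := baseCoeff L (φ x)
  have h1 : r • χ a + r • χ b = x := by
    rw [← smul_add, ← H.coneLinear_inv.map_add a ha b hb, hab, proj,
      H.coneLinear_inv.map_smul _ (inv_pos.2 hp).le _ (H.map_mem x hxC), H.left_inv x hxC,
      smul_smul, mul_inv_cancel₀ hp.ne', one_smul]
  have hra := PointedCone.smul_mem C hp.le (H.map_mem_inv a ha)
  have h2 := hK.eq_smul_of_add_eq_extreme hx hra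
    (PointedCone.smul_mem C hp.le (H.map_mem_inv b hb)) h1
  set s := baseCoeff K (r • χ a)
  have hs : 0 ≤ s := hK.baseCoeff_nonneg hra
  have h3 : r • a = s • φ x := by
    rw [← H.coneLinear.map_smul s hs x hxC, ← h2,
      H.coneLinear.map_smul r hp.le _ (H.map_mem_inv a ha), H.right_inv a ha]
  refine ⟨s, ?_⟩
  rw [proj, smul_comm, ← h3, smul_smul, inv_mul_cancel₀ hp.ne', one_smul]

variable [IsTopologicalAddGroup F] [ContinuousSMul ℝ F] [LocallyConvexSpace ℝ F] [T2Space F]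

theorem continuousOn_baseCoeff (H : IsConeHomeo C D φ χ) (hK : IsBase C K) (hcK : IsCompact K)
    (hL : IsBase D L) (hcL : IsCompact L) : ContinuousOn (fun x => baseCoeff L (φ x)) K := by
  have hφ := H.continuousOn.mono hK.subset
  refine (hL.continuousOn_baseCoeff hcL (hcK.image_of_continuousOn hφ) ?_).comp hφ
    (Set.mapsTo_image φ K)
  rintro _ ⟨k, hk, rfl⟩
  exact H.map_mem k (hK.subset hk)

theorem continuousOn_proj (H : IsConeHomeo C D φ χ) (hK : IsBase C K) (hcK : IsCompact K)
    (hL : IsBase D L) (hcL : IsCompact L) : ContinuousOn (proj L φ) K :=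
  ((H.continuousOn_baseCoeff hK hcK hL hcL).inv₀ fun _ hx =>
    (H.baseCoeff_pos hK hL hx).ne').smul (H.continuousOn.mono hK.subset)

/-- The projective map between two compact bases restricts to a homeomorphism of the extreme
boundaries. -/
noncomputable def extremeHomeo [IsTopologicalAddGroup E] [ContinuousSMul ℝ E]
    [LocallyConvexSpace ℝ E] [T2Space E] (H : IsConeHomeo C D φ χ) (hK : IsBase C K)
    (hcK : IsCompact K) (hL : IsBase D L) (hcL : IsCompact L) :
    K.extremePoints ℝ ≃ₜ L.extremePoints ℝ where
  toFun x := ⟨proj L φ x, H.proj_mem_extremePoints hK hL x.2⟩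
  invFun y := ⟨proj K χ y, H.symm.proj_mem_extremePoints hL hK y.2⟩
  left_inv x := Subtype.ext (H.proj_proj hK hL x.2.1)
  right_inv y := Subtype.ext (H.symm.proj_proj hL hK y.2.1)
  continuous_toFun := ((H.continuousOn_proj hK hcK hL hcL).mono
    extremePoints_subset).domRestrict.subtype_mk _
  continuous_invFun := ((H.symm.continuousOn_proj hL hcL hK hcK).mono
    extremePoints_subset).domRestrict.subtype_mk _

end IsConeHomeo

end SimplexCone

/-! ### The main theorem -/

open SimplexCone in
theorem lemma4p3
    {E : Type u} [AddCommGroup E] [Module ℝ E] [TopologicalSpace E] [IsTopologicalAddGroup E]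
    [ContinuousSMul ℝ E] [LocallyConvexSpace ℝ E] [T2Space E]
    {E' : Type v} [AddCommGroup E'] [Module ℝ E'] [TopologicalSpace E'] [IsTopologicalAddGroup E']
    [ContinuousSMul ℝ E'] [LocallyConvexSpace ℝ E'] [T2Space E']
    (C : PointedCone ℝ E) (C' : PointedCone ℝ E')
    (hC : SimplexCone.IsSimplexCone C) (hC' : SimplexCone.IsSimplexCone C')
    (K : Set E) (hK : IsCompact K) (hKC : SimplexCone.IsBase C K)
    (K' : Set E') (hK' : IsCompact K') (hKC' : SimplexCone.IsBase C' K')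
    (hCC' : SimplexCone.AffinelyHomeomorphic (C : Set E) (C' : Set E')) :
    SimplexCone.StronglyAffinelyIsomorphic K K' ∧
      (SimplexCone.IsBauerSimplex K → SimplexCone.AffinelyHomeomorphic K K') := by
  obtain ⟨φ, χ, H⟩ := hCC'.exists_isConeHomeo hC.1.1
  have hg : ConeLinear C (fun x => baseCoeff K' (φ x)) :=
    hKC'.coneLinear.comp H.coneLinear H.map_mem
  have hgc := H.continuousOn_baseCoeff hKC hK hKC' hK'
  obtain ⟨T, hT, hbij, hfT, hlT, hext⟩ := exists_multiplier hC.1 hKC hK hg hgc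
    fun k hk => H.baseCoeff_pos hKC hKC' hk
  -- The coefficient of `T (χ y)` in `K` is `g (χ y)`, which is the coefficient of `y` in `K'`,
  -- namely `1`.
  have hmem : ∀ y : K', T (χ y) ∈ K := fun y => by
    have hy := hKC'.subset y.2
    refine hKC.mem_of_baseCoeff_eq_one (hbij.mapsTo (H.map_mem_inv _ hy)) ?_
    rw [hfT _ (H.map_mem_inv _ hy), H.right_inv _ hy, hKC'.baseCoeff_eq_one y.2]
  have hinv : Function.Bijective (fun y : K' => (⟨T (χ y), hmem y⟩ : K)) := by
    constructor
    · intro y y' h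
      have hy := hKC'.subset y.2
      have hy' := hKC'.subset y'.2
      have := hbij.injOn (H.map_mem_inv _ hy) (H.map_mem_inv _ hy') (congrArg Subtype.val h)
      rw [Subtype.ext_iff, ← H.right_inv _ hy, this, H.right_inv _ hy']
    · intro x
      obtain ⟨c, hc, hcx⟩ := hbij.surjOn (hKC.subset x.2)
      refine ⟨⟨φ c, hKC'.mem_of_baseCoeff_eq_one (H.map_mem c hc) ?_⟩, Subtype.ext ?_⟩
      · rw [← hfT c hc, hcx, hKC.baseCoeff_eq_one x.2]
      · simp only [H.left_inv c hc, hcx]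
  let e : K' ≃ K := Equiv.ofBijective _ hinv
  have he : IsAffine e :=
    (hT.comp H.coneLinear_inv H.map_mem_inv).isAffine hKC'.subset hmem
  refine ⟨⟨e.symm, he.symm hKC'.convex, H.extremeHomeo hKC hK hKC' hK', fun x => ?_⟩, fun hB => ?_⟩
  · have h1 := (H.extremeHomeo hKC hK hKC' hK' x).2.1
    have : e.symm ⟨x, extremePoints_subset x.2⟩ = ⟨_, h1⟩ := by
      have hx := hKC.subset x.2.1
      have hr := H.baseCoeff_pos hKC hKC' x.2.1
      rw [Equiv.symm_apply_eq]
      refine Subtype.ext ?_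
      -- At an extreme point `T` multiplies by `g x`, which cancels the normalizing factor of the
      -- projective map.
      change (x : E) = T (χ ((baseCoeff K' (φ x))⁻¹ • φ x))
      rw [H.coneLinear_inv.map_smul _ (inv_pos.2 hr).le _ (H.map_mem _ hx), H.left_inv _ hx,
        hT.map_smul _ (inv_pos.2 hr).le _ hx, hext _ x.2, smul_smul, inv_mul_cancel₀ hr.ne',
        one_smul]
    rw [this]
  · obtain ⟨R, hR⟩ := hK.exists_bound_of_continuousOn hgc
    have hTc : ContinuousOn T K := by
      refine continuousOn_of_forall_continuousLinearMap (hKC.isCompact_sublevel hK R)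
        (fun x hx => ⟨hbij.mapsTo (hKC.subset hx), ?_⟩) fun l => ?_
      · rw [hfT _ (hKC.subset hx)]
        exact (le_abs_self _).trans (hR x hx)
      · have hp := (l.coneLinear C).add hg
        have hm := (l.coneLinear C).sub hg
        have hpc := l.continuous.continuousOn.add hgc
        have hmc := l.continuous.continuousOn.sub hgc
        obtain ⟨B₁, -, hB₁⟩ := hKC.exists_bound hK hp hpc
        obtain ⟨B₂, -, hB₂⟩ := hKC.exists_bound hK hm hmc
        exact (((continuousOn_envelope hC.1 hKC hK hp hpc hB₁ hB.2).sub
          (continuousOn_envelope hC.1 hKC hK hm hmc hB₂ hB.2)).div_const 4).congr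
            fun x hx => hlT x (hKC.subset hx) l
    -- Continuity of `T` is known on `K` only, so `χ y` is first normalized into `K` and its
    -- coefficient is restored outside `T`.
    have hcont : ContinuousOn (fun y => T (χ y)) K' := by
      refine ((H.symm.continuousOn_baseCoeff hKC' hK' hKC hK).smul
        (hTc.comp (H.symm.continuousOn_proj hKC' hK' hKC hK)
          fun y hy => H.symm.proj_mem hKC' hKC hy)).congr fun y hy => ?_
      have hr := H.symm.baseCoeff_pos hKC' hKC hy
      change T (χ y) = baseCoeff K (χ y) • T ((baseCoeff K (χ y))⁻¹ • χ y)
      rw [hT.map_smul _ (inv_pos.2 hr).le _ (H.map_mem_inv _ (hKC'.subset hy)), smul_smul,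
        mul_inv_cancel₀ hr.ne', one_smul]
    have hec : Continuous e := hcont.domRestrict.subtype_mk _
    have := isCompact_iff_compactSpace.1 hK'
    exact ⟨(hec.homeoOfEquivCompactToT2 (f := e)).symm, he.symm hKC'.convex⟩
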